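/- Let $H$ be a separable complex Hilbert space and let $C$ be a conjugation on $H$, i.e. a conjugate-linear map $C:H\to H$ with $C^2=I$ and $\langle Cx,Cy\rangle=\langle y,x\rangle$ for all $x,y\in H$. Let $\mathcal O_C$ be the space of all bounded linear operators $X$ on $H$ with $CXC=-X^*$, with the operator norm $\|\cdot\|$. For $1\le p<\infty$ let $\mathcal B_p(H)$ be the Schatten $p$-class, i.e. the compact operators $X$ with $\|X\|_p=(\operatorname{tr}|X|^p)^{1/p}<\infty$, where $|X|=(X^*X)^{1/2}$; let $\mathcal B_\infty(H)$ be the space of all compact operators, with $\|\cdot\|_\infty=\|\cdot\|$. Put $\mathcal O_{C,p}=\mathcal O_C\cap\mathcal B_p(H)$ for $1\le p\le\infty$, with the norm $\|\cdot\|_p$. For a normed space $E$ let $E'$ be its dual space of bounded linear functionals, with the usual dual norm. Then, in each of the following cases, $XT$ is a trace class operator for all $T$ in the first space and all $X$ in the second, and the trace pairing $T\mapsto(X\mapsto\operatorname{tr}(XT))$ is an isometric linear isomorphism of the first space onto the dual of the second: (i) from $(\mathcal O_C,\|\cdot\|)$ onto $(\mathcal O_{C,1},\|\cdot\|_1)'$;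 (ii) from $(\mathcal O_{C,1},\|\cdot\|_1)$ onto $(\mathcal O_{C,\infty},\|\cdot\|)'$; (iii) from $(\mathcal O_{C,p},\|\cdot\|_p)$ onto $(\mathcal O_{C,q},\|\cdot\|_q)'$, whenever $1<p,q<\infty$ and $\frac1p+\frac1q=1$. -/

import Mathlib

open scoped ENNReal InnerProductSpace

universe u

noncomputable section

/-! ### Conjugations and skew-symmetric operators -/

section Skew

variable {H : Type u} [NormedAddCommGroup H] [InnerProductSpace ℂ H] [CompleteSpace H]

/-- A conjugate-linear map `C` on `H` is a conjugation if it is an involution and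
`⟨C x, C y⟩ = ⟨y, x⟩` for all `x`, `y`. -/
structure IsConjugation (C : H →ₛₗ[starRingEnd ℂ] H) : Prop where
  involutive : ∀ x, C (C x) = x
  inner_map_map : ∀ x y, ⟪C x, C y⟫_ℂ = ⟪y, x⟫_ℂ

/-- The space of all bounded operators `X` with `C X C = -X*`; as a submodule of `H →L[ℂ] H` it
carries the operator norm. -/
def skewSymmetric (C : H →ₛₗ[starRingEnd ℂ] H) : Submodule ℂ (H →L[ℂ] H) where
  carrier := {X | ∀ x, C (X (C x)) = -(ContinuousLinearMap.adjoint X x)}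
  add_mem' {X Y} hX hY x := by
    simp only [Set.mem_ofPred_eq] at hX hY
    simp [hX x, hY x, add_comm]
  zero_mem' x := by simp
  smul_mem' c X hX x := by
    simp only [Set.mem_ofPred_eq] at hX
    have h : ContinuousLinearMap.adjoint (c • X) = (starRingEnd ℂ) c • ContinuousLinearMap.adjoint X :=
      map_smulₛₗ _ c X
    simp [hX x, h]

end Skew

/-! ### Schatten classes -/

theorem tsum_enorm_inner_sq_le {H : Type u} [NormedAddCommGroup H] [InnerProductSpace ℂ H]
    {κ : Type*} {e : κ → H} (he : Orthonormal ℂ e) (x : H) :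
    ∑' k, ‖⟪e k, x⟫_ℂ‖ₑ ^ 2 ≤ ‖x‖ₑ ^ 2 := by
  have h5 : ∀ z : ℂ, ‖z‖ₑ ^ 2 = ENNReal.ofReal (‖z‖ ^ 2) := by
    intro z
    rw [ENNReal.ofReal_pow (norm_nonneg _), ofReal_norm]
  simp_rw [h5]
  rw [← ENNReal.ofReal_tsum_of_nonneg (fun _ => by positivity) (he.inner_products_summable x),
    ← ofReal_norm, ← ENNReal.ofReal_pow (norm_nonneg _)]
  exact ENNReal.ofReal_le_ofReal (he.tsum_inner_products_le x)

theorem tsum_enorm_inner_sq {H : Type u} [NormedAddCommGroup H] [InnerProductSpace ℂ H]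
    {ι : Type*} (b : HilbertBasis ι ℂ H) (x : H) :
    ∑' i, ‖⟪b i, x⟫_ℂ‖ₑ ^ 2 = ‖x‖ₑ ^ 2 := by
  have h := b.hasSum_inner_mul_inner x x
  have h2 : HasSum (fun i => ‖⟪b i, x⟫_ℂ‖ ^ 2) (‖x‖ ^ 2) := by
    have h4 := h.mapL Complex.reCLM
    rw [inner_self_eq_norm_sq_to_K] at h4
    convert h4 using 1
    · funext i
      rw [← inner_conj_symm x (b i), RCLike.conj_mul]
      norm_cast
    · norm_cast
  have h5 : ∀ z : ℂ, ‖z‖ₑ ^ 2 = ENNReal.ofReal (‖z‖ ^ 2) := by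
    intro z
    rw [ENNReal.ofReal_pow (norm_nonneg _), ofReal_norm]
  simp_rw [h5]
  rw [← ENNReal.ofReal_tsum_of_nonneg (fun _ => by positivity) h2.summable, h2.tsum_eq,
    ENNReal.ofReal_pow (norm_nonneg _), ofReal_norm]

section Schatten

variable (H : Type u) [NormedAddCommGroup H] [InnerProductSpace ℂ H] [CompleteSpace H]

/-- The index set of a fixed Hilbert basis of `H`. -/
def stdIndex : Set H := (exists_hilbertBasis ℂ H).choose

/-- A fixed Hilbert basis of `H`. -/
def stdBasis : HilbertBasis (stdIndex H) ℂ H :=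
  (exists_hilbertBasis ℂ H).choose_spec.choose

variable {H}

/-- The trace `∑ᵢ ⟨P eᵢ, eᵢ⟩ ∈ [0, ∞]` of a positive operator `P`. It does not depend on the
orthonormal basis, see `posTrace_eq`. -/
def posTrace (P : H →L[ℂ] H) : ℝ≥0∞ :=
  ∑' i, ENNReal.ofReal (RCLike.re ⟪stdBasis H i, P (stdBasis H i)⟫_ℂ)

/-- The extended Schatten norm: `(tr |T|^p)^(1/p)` for `p < ∞`, where `|T| = (T* T)^(1/2)`, and the
operator norm for `p = ∞`. -/
def schattenENorm (p : ℝ≥0∞) (T : H →L[ℂ] H) : ℝ≥0∞ :=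
  if p = ∞ then ‖T‖ₑ else posTrace (CFC.abs T ^ p.toReal) ^ (1 / p.toReal)

/-! Auxiliary facts, which show that the Schatten norms are norms. -/

theorem tsum_enorm_sq_adjoint {ι κ : Type*} (b : HilbertBasis ι ℂ H) (c : HilbertBasis κ ℂ H)
    (Q : H →L[ℂ] H) :
    ∑' i, ‖Q (b i)‖ₑ ^ 2 = ∑' j, ‖ContinuousLinearMap.adjoint Q (c j)‖ₑ ^ 2 := by
  simp_rw [← tsum_enorm_inner_sq c (Q _), ← tsum_enorm_inner_sq b (ContinuousLinearMap.adjoint Q _)]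
  rw [ENNReal.tsum_comm]
  refine tsum_congr fun j => tsum_congr fun i => ?_
  rw [ContinuousLinearMap.adjoint_inner_right, ← inner_conj_symm, RCLike.enorm_conj]

theorem posTrace_eq {ι : Type*} (b : HilbertBasis ι ℂ H) {P : H →L[ℂ] H} (hP : 0 ≤ P) :
    posTrace P = ∑' i, ENNReal.ofReal (RCLike.re ⟪b i, P (b i)⟫_ℂ) := by
  obtain ⟨Q, rfl⟩ := CStarAlgebra.nonneg_iff_eq_star_mul_self.1 hP
  have key : ∀ x : H, ENNReal.ofReal (RCLike.re ⟪x, (star Q * Q) x⟫_ℂ) = ‖Q x‖ₑ ^ 2 := by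
    intro x
    rw [ContinuousLinearMap.star_eq_adjoint, mul_apply_eq_comp,
      ContinuousLinearMap.adjoint_inner_right, inner_self_eq_norm_sq,
      ENNReal.ofReal_pow (norm_nonneg _), ofReal_norm]
  unfold posTrace
  simp_rw [key]
  rw [tsum_enorm_sq_adjoint (stdBasis H) b, ← tsum_enorm_sq_adjoint b b]

theorem cfc_apply_of_apply_eq_smul {A : H →L[ℂ] H} (hA : IsSelfAdjoint A) {l : ℝ} {x : H}
    (hx : A x = (l : ℂ) • x) {f : ℝ → ℝ} (hf : Continuous f) :
    cfc f A x = (f l : ℂ) • x := by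
  by_cases hx0 : x = 0
  · simp [hx0]
  have hl : l ∈ spectrum ℝ A := by
    rw [spectrum.mem_iff]
    intro hu
    apply hx0
    have h1 : (algebraMap ℝ (H →L[ℂ] H) l - A) x = 0 := by
      simp [Algebra.algebraMap_eq_smul_one, hx]
    obtain ⟨v, hv⟩ := hu
    have h2 : ((↑v⁻¹ : H →L[ℂ] H) * (v : H →L[ℂ] H)) x = x := by simp
    rw [← h2, mul_apply_eq_comp, hv, h1, map_zero]
  have : ∀ g : C(spectrum ℝ A, ℝ), cfcHom hA g x = (g ⟨l, hl⟩ : ℂ) • x := by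
    intro g
    induction g using ContinuousMap.induction_on_of_compact with
    | const r =>
      have : (ContinuousMap.const (spectrum ℝ A) r) = algebraMap ℝ C(spectrum ℝ A, ℝ) r := rfl
      rw [this, AlgHomClass.commutes]
      change ((r : ℂ) • (1 : H →L[ℂ] H)) x = (r : ℂ) • x
      simp
    | id =>
      rw [cfcHom_id hA, hx]
      rfl
    | star_id =>
      rw [map_star, cfcHom_id hA, hA.star_eq, hx]
      rfl
    | add f g hf hg =>
      rw [map_add, add_apply, hf, hg, ContinuousMap.add_apply, Complex.ofReal_add,
        add_smul]
    | mul f g hf hg =>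
      rw [map_mul, mul_apply_eq_comp, hg, map_smul, hf, ContinuousMap.mul_apply, Complex.ofReal_mul,
        smul_smul, mul_comm]
    | frequently f h =>
      have hc : IsClosed {g : C(spectrum ℝ A, ℝ) | cfcHom hA g x = (g ⟨l, hl⟩ : ℂ) • x} := by
        refine isClosed_eq ?_ ?_
        · exact (ContinuousLinearMap.apply ℂ H x).continuous.comp (cfcHom_continuous hA)
        · fun_prop
      exact hc.closure_subset (mem_closure_iff_frequently.2 h)
  rw [cfc_apply f A hA hf.continuousOn, this]
  simp

theorem rpow_apply_of_apply_eq_smul {A : H →L[ℂ] H} (hA : 0 ≤ A) {l r : ℝ} (hr : 0 < r) {x : H}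
    (hx : A x = (l : ℂ) • x) : (A ^ r) x = ((l ^ r : ℝ) : ℂ) • x := by
  rw [CFC.rpow_eq_cfc_real hA]
  exact cfc_apply_of_apply_eq_smul (IsSelfAdjoint.of_nonneg hA) hx
    (Real.continuous_rpow_const hr.le)

/-- A compact operator `T` has a Hilbert basis of eigenvectors of `T* T`. -/
theorem exists_eigenbasis {T : H →L[ℂ] H} (hT : IsCompactOperator T) :
    ∃ (ι : Type u) (a : HilbertBasis ι ℂ H),
      ∀ i, (star T * T) (a i) = ((‖T (a i)‖ ^ 2 : ℝ) : ℂ) • a i := by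
  set A : H →L[ℂ] H := star T * T with hAdef
  have hA : IsCompactOperator A := hT.clm_comp (star T)
  have hsa : IsSelfAdjoint A := IsSelfAdjoint.star_mul_self T
  have hsym : (A : H →ₗ[ℂ] H).IsSymmetric := hsa.isSymmetric
  let E : ℂ → Submodule ℂ H := fun μ => Module.End.eigenspace (A : Module.End ℂ H) μ
  have hE : ∀ μ, IsClosed (E μ : Set H) := by
    intro μ
    have : (E μ : Set H) = {x | A x = μ • x} := by
      ext x; simp [E]
    rw [this]
    exact isClosed_eq (by fun_prop) (by fun_prop)
  have : ∀ μ, CompleteSpace (E μ) := fun μ => (hE μ).completeSpace_coe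
  let w : ∀ μ, Set (E μ) := fun μ => stdIndex (E μ)
  let b : ∀ μ, HilbertBasis (w μ) ℂ (E μ) := fun μ => stdBasis (E μ)
  have hon : Orthonormal ℂ (fun a : Σ μ, w μ => ((b a.1 a.2 : E a.1) : H)) :=
    hsym.orthogonalFamily_eigenspaces.orthonormal_sigma_orthonormal
      (v_family := fun μ i => b μ i) (fun μ => (b μ).orthonormal)
  have hbot : (Submodule.span ℂ (Set.range fun a : Σ μ, w μ => ((b a.1 a.2 : E a.1) : H)))ᗮ = ⊥ := by
    rw [eq_bot_iff, ← ContinuousLinearMap.orthogonalComplement_iSup_eigenspaces_eq_bot hA hsym,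
      ← Submodule.iInf_orthogonal, le_iInf_iff]
    intro μ x hx
    rw [Submodule.mem_orthogonal'] at hx ⊢
    intro y hy
    have h1 : HasSum (fun i => ((b μ).repr ⟨y, hy⟩ i) • ((b μ i : E μ) : H)) y :=
      ((b μ).hasSum_repr ⟨y, hy⟩).mapL (E μ).subtypeL
    have h2 := h1.mapL (innerSL ℂ x)
    refine h2.unique ?_
    convert hasSum_zero with i
    simp only [innerSL_apply_apply, inner_smul_right]
    rw [hx _ (Submodule.subset_span ⟨⟨μ, i⟩, rfl⟩), mul_zero]
  refine ⟨_, HilbertBasis.mkOfOrthogonalEqBot hon hbot, ?_⟩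
  rintro ⟨μ, i⟩
  rw [HilbertBasis.coe_mkOfOrthogonalEqBot]
  have hv : A ((b μ i : E μ) : H) = μ • ((b μ i : E μ) : H) :=
    Module.End.mem_eigenspace_iff.1 (b μ i).2
  have hn : ‖((b μ i : E μ) : H)‖ = 1 := (b μ).orthonormal.1 i
  have hμ : μ = ((‖T ((b μ i : E μ) : H)‖ ^ 2 : ℝ) : ℂ) := by
    have h1 : ⟪((b μ i : E μ) : H), A ((b μ i : E μ) : H)⟫_ℂ = μ := by
      rw [hv, inner_smul_right, inner_self_eq_norm_sq_to_K, hn]; simp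
    refine h1.symm.trans ?_
    rw [hAdef, ContinuousLinearMap.star_eq_adjoint, mul_apply_eq_comp,
      ContinuousLinearMap.adjoint_inner_right, inner_self_eq_norm_sq_to_K]
    norm_cast
  change A ((b μ i : E μ) : H) = _
  rw [hv]
  exact congrArg (· • ((b μ i : E μ) : H)) hμ

theorem abs_rpow_apply_of_eigen {T : H →L[ℂ] H} {p : ℝ} (hp : 0 < p) {x : H}
    (hx : (star T * T) x = ((‖T x‖ ^ 2 : ℝ) : ℂ) • x) :
    (CFC.abs T ^ p) x = ((‖T x‖ ^ p : ℝ) : ℂ) • x := by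
  refine rpow_apply_of_apply_eq_smul (CFC.abs_nonneg T) hp ?_
  rw [CFC.abs, CFC.sqrt_eq_rpow, rpow_apply_of_apply_eq_smul (star_mul_self_nonneg T) (by norm_num) hx,
    ← Real.sqrt_eq_rpow, Real.sqrt_sq (norm_nonneg _)]

theorem posTrace_abs_rpow {T : H →L[ℂ] H} {p : ℝ} (hp : 0 < p) {ι : Type*}
    (a : HilbertBasis ι ℂ H)
    (ha : ∀ i, (star T * T) (a i) = ((‖T (a i)‖ ^ 2 : ℝ) : ℂ) • a i) :
    posTrace (CFC.abs T ^ p) = ∑' i, ‖T (a i)‖ₑ ^ p := by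
  rw [posTrace_eq a CFC.rpow_nonneg]
  refine tsum_congr fun i => ?_
  rw [abs_rpow_apply_of_eigen hp (ha i), inner_smul_right, inner_self_eq_norm_sq_to_K,
    a.orthonormal.1 i]
  simp [← ENNReal.ofReal_rpow_of_nonneg (norm_nonneg (T (a i))) hp.le]

theorem enorm_tsum_le {ι : Type*} {f : ι → ℂ} {z : ℂ} (h : HasSum f z) :
    ‖z‖ₑ ≤ ∑' i, ‖f i‖ₑ := by
  refine le_of_tendsto (h.enorm) (Filter.Eventually.of_forall fun s => ?_)
  exact (enorm_sum_le s f).trans (ENNReal.sum_le_tsum s)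

/-- Jensen's inequality for weights of total mass at most one. -/
theorem tsum_mul_rpow_le {ι : Type*} {p : ℝ} (hp : 1 ≤ p) (w f : ι → ℝ≥0∞) (hw : ∑' i, w i ≤ 1) :
    (∑' i, w i * f i) ^ p ≤ ∑' i, w i * f i ^ p := by
  have hp0 : 0 < p := by linarith
  rw [← ENNReal.le_rpow_inv_iff hp0, ENNReal.tsum_eq_iSup_sum]
  refine iSup_le fun s => ?_
  refine (ENNReal.inner_le_weight_mul_Lp_of_nonneg s hp w f).trans ?_
  have h1 : (∑ i ∈ s, w i) ^ (1 - p⁻¹) ≤ 1 :=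
    ENNReal.rpow_le_one ((ENNReal.sum_le_tsum s).trans hw)
      (by have := inv_le_one_of_one_le₀ hp; linarith)
  calc _ ≤ 1 * (∑' i, w i * f i ^ p) ^ p⁻¹ := by
        gcongr
        exact ENNReal.sum_le_tsum s
    _ = _ := one_mul _

/-- Minkowski's inequality for arbitrary families. -/
theorem tsum_add_rpow_le {ι : Type*} {p : ℝ} (hp : 1 ≤ p) (f g : ι → ℝ≥0∞) :
    (∑' i, (f i + g i) ^ p) ^ (1 / p) ≤
      (∑' i, f i ^ p) ^ (1 / p) + (∑' i, g i ^ p) ^ (1 / p) := by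
  have hp0 : 0 < p := by linarith
  rw [one_div, ENNReal.rpow_inv_le_iff hp0, ENNReal.tsum_eq_iSup_sum]
  refine iSup_le fun s => ?_
  rw [← ENNReal.rpow_inv_le_iff hp0, ← one_div]
  refine (ENNReal.Lp_add_le s f g hp).trans ?_
  gcongr <;> exact ENNReal.sum_le_tsum s

/-- The nonzero vectors among the `T aᵢ`, normalized, are orthonormal. -/
theorem orthonormal_normalize {T : H →L[ℂ] H} {ι : Type*} (a : HilbertBasis ι ℂ H)
    (ha : ∀ i, (star T * T) (a i) = ((‖T (a i)‖ ^ 2 : ℝ) : ℂ) • a i) :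
    Orthonormal ℂ (fun i : {i // T (a i) ≠ 0} => ((‖T (a i)‖⁻¹ : ℝ) : ℂ) • T (a i)) := by
  constructor
  · rintro ⟨i, hi⟩
    have : ‖T (a i)‖ ≠ 0 := norm_ne_zero_iff.2 hi
    simp [norm_smul, this]
  · rintro ⟨i, hi⟩ ⟨j, hj⟩ hij
    have h : ⟪T (a i), T (a j)⟫_ℂ = 0 := by
      rw [← ContinuousLinearMap.adjoint_inner_right, ← ContinuousLinearMap.star_eq_adjoint,
        ← mul_apply_eq_comp, ha, inner_smul_right, a.orthonormal.2 (fun h => hij (Subtype.ext h)),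
        mul_zero]
    simp [inner_smul_left, inner_smul_right, h]

theorem tsum_enorm_inner_rpow_le {T : H →L[ℂ] H} {p : ℝ} (hp : 1 ≤ p) {ι : Type*}
    (a : HilbertBasis ι ℂ H)
    (ha : ∀ i, (star T * T) (a i) = ((‖T (a i)‖ ^ 2 : ℝ) : ℂ) • a i)
    {κ : Type*} {e f : κ → H} (he : Orthonormal ℂ e) (hf : Orthonormal ℂ f) :
    ∑' k, ‖⟪f k, T (e k)⟫_ℂ‖ₑ ^ p ≤ ∑' i, ‖T (a i)‖ₑ ^ p := by
  let g : ι → H := fun i => ((‖T (a i)‖⁻¹ : ℝ) : ℂ) • T (a i)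
  have hg : ∀ i, T (a i) = (‖T (a i)‖ : ℂ) • g i := by
    intro i
    by_cases h : T (a i) = 0
    · simp [g, h]
    · have : (‖T (a i)‖ : ℂ) ≠ 0 := by simpa using h
      simp [g, smul_smul, this]
  have hgs : ∀ x : H, ∑' i, ‖⟪g i, x⟫_ℂ‖ₑ ^ 2 ≤ ‖x‖ₑ ^ 2 := by
    intro x
    have h := tsum_enorm_inner_sq_le (orthonormal_normalize a ha) x
    refine le_of_eq_of_le ?_ h
    refine (tsum_subtype_eq_of_support_subset (f := fun i => ‖⟪g i, x⟫_ℂ‖ₑ ^ 2)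
      (s := {i | T (a i) ≠ 0}) ?_).symm
    intro i hi
    by_contra h0
    have h0' : T (a i) = 0 := by simpa using h0
    apply hi
    simp [g, h0']
  have hag : ∀ x y : ℂ, ‖x‖ₑ * ‖y‖ₑ ≤ 2⁻¹ * (‖x‖ₑ ^ 2 + ‖y‖ₑ ^ 2) := by
    intro x y
    have h : 2 * ‖x‖₊ * ‖y‖₊ ≤ ‖x‖₊ ^ 2 + ‖y‖₊ ^ 2 := two_mul_le_add_sq _ _
    have h' : (2 : ℝ≥0∞) * (‖x‖ₑ * ‖y‖ₑ) ≤ ‖x‖ₑ ^ 2 + ‖y‖ₑ ^ 2 := by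
      rw [← mul_assoc]
      simp only [enorm_eq_nnnorm]
      exact_mod_cast h
    calc ‖x‖ₑ * ‖y‖ₑ = 2⁻¹ * (2 * (‖x‖ₑ * ‖y‖ₑ)) := by
          rw [← mul_assoc, ENNReal.inv_mul_cancel (by norm_num) (by norm_num), one_mul]
      _ ≤ _ := by gcongr
  let w : κ → ι → ℝ≥0∞ := fun k i => 2⁻¹ * (‖⟪a i, e k⟫_ℂ‖ₑ ^ 2 + ‖⟪g i, f k⟫_ℂ‖ₑ ^ 2)
  have half : ∀ x y : ℝ≥0∞, x ≤ 1 → y ≤ 1 → 2⁻¹ * (x + y) ≤ 1 := by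
    intro x y hx hy
    calc 2⁻¹ * (x + y) ≤ 2⁻¹ * (1 + 1) := by gcongr
      _ = 1 := by rw [one_add_one_eq_two, ENNReal.inv_mul_cancel (by norm_num) (by norm_num)]
  have unit : ∀ {x : H}, ‖x‖ = 1 → ‖x‖ₑ ^ 2 = 1 := by
    intro x hx
    rw [← ofReal_norm, hx]; simp
  have hw1 : ∀ k, ∑' i, w k i ≤ 1 := by
    intro k
    simp only [w, ENNReal.tsum_mul_left, ENNReal.tsum_add]
    refine half _ _ ?_ ?_
    · rw [tsum_enorm_inner_sq a, unit (he.1 k)]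
    · exact (hgs (f k)).trans (unit (hf.1 k)).le
  have hgn : ∀ i, ‖g i‖ₑ ^ 2 ≤ 1 := by
    intro i
    by_cases h : T (a i) = 0
    · simp [g, h]
    · exact (unit ((orthonormal_normalize a ha).1 ⟨i, h⟩)).le
  have hsymm : ∀ x y : H, ‖⟪x, y⟫_ℂ‖ₑ = ‖⟪y, x⟫_ℂ‖ₑ := by
    intro x y
    rw [← inner_conj_symm, RCLike.enorm_conj]
  have hw2 : ∀ i, ∑' k, w k i ≤ 1 := by
    intro i
    simp only [w, ENNReal.tsum_mul_left, ENNReal.tsum_add]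
    refine half _ _ ?_ ?_
    · simp_rw [hsymm (a i)]
      exact (tsum_enorm_inner_sq_le he (a i)).trans (unit (a.orthonormal.1 i)).le
    · simp_rw [hsymm (g i)]
      exact (tsum_enorm_inner_sq_le hf (g i)).trans (hgn i)
  have hk : ∀ k, ‖⟪f k, T (e k)⟫_ℂ‖ₑ ≤ ∑' i, w k i * ‖T (a i)‖ₑ := by
    intro k
    have h1 := ((a.hasSum_repr (e k)).mapL T).mapL (innerSL ℂ (f k))
    refine (enorm_tsum_le h1).trans (ENNReal.tsum_le_tsum fun i => ?_)
    have h2 : ‖⟪f k, T (a i)⟫_ℂ‖ₑ = ‖T (a i)‖ₑ * ‖⟪g i, f k⟫_ℂ‖ₑ := by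
      conv_lhs => rw [hg i]
      rw [inner_smul_right, enorm_mul, hsymm (f k)]
      congr 1
      rw [← ofReal_norm, ← ofReal_norm]; simp
    simp only [map_smul, innerSL_apply_apply, smul_eq_mul, enorm_mul, a.repr_apply_apply]
    rw [h2, mul_left_comm, mul_comm]
    gcongr
    exact hag _ _
  calc ∑' k, ‖⟪f k, T (e k)⟫_ℂ‖ₑ ^ p ≤ ∑' k, ∑' i, w k i * ‖T (a i)‖ₑ ^ p := by
        refine ENNReal.tsum_le_tsum fun k => ?_
        exact (ENNReal.rpow_le_rpow (hk k) (by linarith)).trans (tsum_mul_rpow_le hp _ _ (hw1 k))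
    _ = ∑' i, ∑' k, w k i * ‖T (a i)‖ₑ ^ p := ENNReal.tsum_comm
    _ ≤ ∑' i, 1 * ‖T (a i)‖ₑ ^ p := by
        refine ENNReal.tsum_le_tsum fun i => ?_
        rw [ENNReal.tsum_mul_right]
        gcongr
        exact hw2 i
    _ = _ := by simp

theorem schattenENorm_of_eigenbasis {p : ℝ≥0∞} (hp1 : 1 ≤ p) (hp : p ≠ ∞) {T : H →L[ℂ] H}
    {ι : Type*} (a : HilbertBasis ι ℂ H)
    (ha : ∀ i, (star T * T) (a i) = ((‖T (a i)‖ ^ 2 : ℝ) : ℂ) • a i) :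
    schattenENorm p T = (∑' i, ‖T (a i)‖ₑ ^ p.toReal) ^ (1 / p.toReal) := by
  rw [schattenENorm, if_neg hp,
    posTrace_abs_rpow (ENNReal.toReal_pos (by positivity) hp) a ha]

/-- For a compact operator `T`, `∑ₖ |⟨T eₖ, fₖ⟩|^p ≤ ‖T‖ₚ^p` for all orthonormal families. -/
theorem tsum_enorm_inner_le_schattenENorm {p : ℝ≥0∞} (hp1 : 1 ≤ p) (hp : p ≠ ∞) {T : H →L[ℂ] H}
    (hT : IsCompactOperator T) {κ : Type*} {e f : κ → H} (he : Orthonormal ℂ e)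
    (hf : Orthonormal ℂ f) :
    (∑' k, ‖⟪f k, T (e k)⟫_ℂ‖ₑ ^ p.toReal) ^ (1 / p.toReal) ≤ schattenENorm p T := by
  obtain ⟨ι, a, ha⟩ := exists_eigenbasis hT
  rw [schattenENorm_of_eigenbasis hp1 hp a ha]
  have h1 : 1 ≤ p.toReal := by simpa using ENNReal.toReal_mono hp hp1
  exact ENNReal.rpow_le_rpow (tsum_enorm_inner_rpow_le h1 a ha he hf) (by positivity)

theorem schattenENorm_add_le {p : ℝ≥0∞} (hp1 : 1 ≤ p) {S T : H →L[ℂ] H}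
    (hS : IsCompactOperator S) (hT : IsCompactOperator T) :
    schattenENorm p (S + T) ≤ schattenENorm p S + schattenENorm p T := by
  by_cases hp : p = ∞
  · simp only [schattenENorm, if_pos hp]
    exact enorm_add_le S T
  have h1 : 1 ≤ p.toReal := by simpa using ENNReal.toReal_mono hp hp1
  have hp0 : 0 < p.toReal := by linarith
  obtain ⟨ι, a, ha⟩ := exists_eigenbasis (T := S + T) (hS.add hT)
  have hf := orthonormal_normalize a ha
  have he : Orthonormal ℂ (fun i : {i // (S + T) (a i) ≠ 0} => a i) :=
    a.orthonormal.comp _ Subtype.val_injective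
  refine le_trans ?_ (add_le_add (tsum_enorm_inner_le_schattenENorm hp1 hp hS he hf)
    (tsum_enorm_inner_le_schattenENorm hp1 hp hT he hf))
  refine le_trans ?_ (tsum_add_rpow_le h1 _ _)
  rw [schattenENorm_of_eigenbasis hp1 hp a ha]
  refine ENNReal.rpow_le_rpow ?_ (by positivity)
  rw [← tsum_subtype_eq_of_support_subset (f := fun i => ‖(S + T) (a i)‖ₑ ^ p.toReal)
    (s := {i | (S + T) (a i) ≠ 0})]
  · refine ENNReal.tsum_le_tsum fun i => ENNReal.rpow_le_rpow ?_ hp0.le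
    refine le_trans ?_ (enorm_add_le _ _)
    rw [← inner_add_right, ← add_apply, inner_smul_left,
      inner_self_eq_norm_sq_to_K, ← ofReal_norm, ← ofReal_norm]
    have : ‖(S + T) (a i)‖ ≠ 0 := norm_ne_zero_iff.2 i.2
    refine ENNReal.ofReal_le_ofReal (le_of_eq ?_)
    simp only [Complex.conj_ofReal, norm_mul, Complex.norm_real, norm_inv, norm_norm, norm_pow,
      Complex.coe_algebraMap]
    field_simp
  · intro i hi h0
    apply hi
    simp only [h0, enorm_zero, ENNReal.zero_rpow_of_pos hp0]

theorem schattenENorm_smul {p : ℝ≥0∞} (hp1 : 1 ≤ p) (c : ℂ) {T : H →L[ℂ] H}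
    (hT : IsCompactOperator T) :
    schattenENorm p (c • T) = ‖c‖ₑ * schattenENorm p T := by
  by_cases hp : p = ∞
  · simp only [schattenENorm, if_pos hp]
    exact enorm_smul c T
  have hp0 : 0 < p.toReal := ENNReal.toReal_pos (by positivity) hp
  obtain ⟨ι, a, ha⟩ := exists_eigenbasis hT
  have ha' : ∀ i, (star (c • T) * (c • T)) (a i) = ((‖(c • T) (a i)‖ ^ 2 : ℝ) : ℂ) • a i := by
    intro i
    have : star (c • T) * (c • T) = (star c * c) • (star T * T) := by
      rw [star_smul, smul_mul_smul_comm]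
    rw [this, smul_apply, ha, smul_smul, smul_apply,
      norm_smul, mul_pow]
    congr 1
    push_cast
    congr 1
    exact Complex.conj_mul' c
  rw [schattenENorm_of_eigenbasis hp1 hp a ha, schattenENorm_of_eigenbasis hp1 hp a ha']
  simp only [smul_apply, enorm_smul, ENNReal.mul_rpow_of_nonneg _ _ hp0.le]
  rw [ENNReal.tsum_mul_left, ENNReal.mul_rpow_of_nonneg _ _ (by positivity), one_div,
    ENNReal.rpow_rpow_inv hp0.ne']

theorem schattenENorm_zero {p : ℝ≥0∞} (hp1 : 1 ≤ p) : schattenENorm p (0 : H →L[ℂ] H) = 0 := by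
  have h := schattenENorm_smul hp1 0 (T := (0 : H →L[ℂ] H)) isCompactOperator_zero
  rwa [zero_smul, enorm_zero, zero_mul] at h

theorem eq_zero_of_schattenENorm {p : ℝ≥0∞} (hp1 : 1 ≤ p) {T : H →L[ℂ] H}
    (hT : IsCompactOperator T) (h : schattenENorm p T = 0) : T = 0 := by
  by_cases hp : p = ∞
  · simpa [schattenENorm, if_pos hp] using h
  have hp0 : 0 < p.toReal := ENNReal.toReal_pos (by positivity) hp
  obtain ⟨ι, a, ha⟩ := exists_eigenbasis hT
  rw [schattenENorm_of_eigenbasis hp1 hp a ha, ENNReal.rpow_eq_zero_iff_of_pos (by positivity),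
    ENNReal.tsum_eq_zero] at h
  ext x
  have h1 := (a.hasSum_repr x).mapL T
  refine h1.unique ?_
  have h2 : ∀ i, T (a i) = 0 := by
    intro i
    simpa [ENNReal.rpow_eq_zero_iff_of_pos hp0] using h i
  simp [h2]

/-- The Schatten `p`-class `B_p(H)`: the compact operators `T` with `‖T‖ₚ < ∞`. For `p = ∞` it
consists of all compact operators. -/
def schattenClass (H : Type u) [NormedAddCommGroup H] [InnerProductSpace ℂ H] [CompleteSpace H]
    (p : ℝ≥0∞) [Fact (1 ≤ p)] : Submodule ℂ (H →L[ℂ] H) where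
  carrier := {T | IsCompactOperator T ∧ schattenENorm p T < ∞}
  add_mem' {S T} hS hT :=
    ⟨hS.1.add hT.1, (schattenENorm_add_le Fact.out hS.1 hT.1).trans_lt
      (ENNReal.add_lt_top.2 ⟨hS.2, hT.2⟩)⟩
  zero_mem' := ⟨isCompactOperator_zero, by rw [schattenENorm_zero Fact.out]; exact ENNReal.zero_lt_top⟩
  smul_mem' c T hT :=
    ⟨hT.1.smul c, by
      rw [schattenENorm_smul Fact.out c hT.1]
      exact ENNReal.mul_lt_top enorm_lt_top hT.2⟩

/-- The Schatten class `B_p(H)` as a normed space of its own, with the norm `‖·‖ₚ`. -/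
def SchattenSpace (H : Type u) [NormedAddCommGroup H] [InnerProductSpace ℂ H] [CompleteSpace H]
    (p : ℝ≥0∞) [Fact (1 ≤ p)] : Type u :=
  schattenClass H p

namespace SchattenSpace

variable {p : ℝ≥0∞} [Fact (1 ≤ p)]

instance : AddCommGroup (SchattenSpace H p) := inferInstanceAs (AddCommGroup (schattenClass H p))

instance : Module ℂ (SchattenSpace H p) := inferInstanceAs (Module ℂ (schattenClass H p))

/-- The inclusion of `B_p(H)` into the bounded operators. -/
def toCLM : SchattenSpace H p →ₗ[ℂ] (H →L[ℂ] H) := (schattenClass H p).subtype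

theorem toCLM_mem (T : SchattenSpace H p) : toCLM T ∈ schattenClass H p := T.2

instance : Norm (SchattenSpace H p) := ⟨fun T => (schattenENorm p (toCLM T)).toReal⟩

theorem norm_def (T : SchattenSpace H p) : ‖T‖ = (schattenENorm p (toCLM T)).toReal := rfl

theorem normedSpaceCore : NormedSpace.Core ℂ (SchattenSpace H p) where
  norm_nonneg _ := ENNReal.toReal_nonneg
  norm_smul c T := by
    rw [norm_def, norm_def, map_smul, schattenENorm_smul Fact.out c (toCLM_mem T).1, ENNReal.toReal_mul]
    simp
  norm_triangle S T := by
    rw [norm_def, norm_def, norm_def, map_add, ← ENNReal.toReal_add (toCLM_mem S).2.ne (toCLM_mem T).2.ne]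
    exact ENNReal.toReal_mono (ENNReal.add_lt_top.2 ⟨S.2.2, T.2.2⟩).ne
      (schattenENorm_add_le Fact.out S.2.1 T.2.1)
  norm_eq_zero_iff T := by
    constructor
    · intro h
      rw [norm_def, ENNReal.toReal_eq_zero_iff] at h
      exact Subtype.ext (eq_zero_of_schattenENorm Fact.out T.2.1 (h.resolve_right T.2.2.ne))
    · rintro rfl
      rw [norm_def, map_zero, schattenENorm_zero Fact.out, ENNReal.toReal_zero]

instance : NormedAddCommGroup (SchattenSpace H p) := NormedAddCommGroup.ofCore normedSpaceCore

instance : NormedSpace ℂ (SchattenSpace H p) := NormedSpace.ofCore normedSpaceCore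

end SchattenSpace

/-- The skew-symmetric operators in the Schatten `p`-class, with the norm `‖·‖ₚ`. -/
def skewSchatten (C : H →ₛₗ[starRingEnd ℂ] H) (p : ℝ≥0∞) [Fact (1 ≤ p)] :
    Submodule ℂ (SchattenSpace H p) :=
  (skewSymmetric C).comap SchattenSpace.toCLM

/-- `A` is a trace class operator with trace `z`, that is, `z = ∑ᵢ ⟨A eᵢ, eᵢ⟩` for every
orthonormal basis `(eᵢ)` of `H`. -/
def HasTrace (A : H →L[ℂ] H) (z : ℂ) : Prop :=
  A ∈ schattenClass H 1 ∧
    ∀ (ι : Type u) (b : HilbertBasis ι ℂ H), HasSum (fun i => ⟪b i, A (b i)⟫_ℂ) z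

end Schatten

end

/-! Write `Xᵗ = C X* C`. This is a complex-linear involution that preserves every Schatten norm, and
the skew-symmetric operators form its `-1` eigenspace, so `X ↦ (X - Xᵗ) / 2` is a contractive
projection onto them. For skew `T` the functional `X ↦ tr (X T)` changes sign under `X ↦ Xᵗ`. Hence
it factors through the projection and has the same norm on the skew part as on the whole class.
Conversely, a functional on the skew part extends by composition with the projection, and the
operator representing the extension may be replaced by its skew part. Each duality thus descends
from the one for the full Schatten class (`IsConjugation.exists_skew_duality`).

For the full classes, a functional `φ` on `B_q` is determined by its values on operators of rank
one, because finite rank operators are dense (`SchattenSpace.dual_ext`). These values form a bounded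
sesquilinear form `⟨y, T x⟩`. When `p < ∞`, testing `φ` on `∑ₖ cₖ ⟨fₖ, ·⟩ eₖ` with extremal `cₖ`
bounds `(∑ₖ |⟨fₖ, T eₖ⟩|^p)^(1/p)` by `‖φ‖`. This forces `T` to be compact and then, along its
singular vectors, gives `‖T‖ₚ ≤ ‖φ‖`. The opposite estimate is Hölder's inequality
(`schattenENorm_one_mul_le`) or, at the endpoints, the ideal property of the trace class.

The estimates use Bessel families instead of orthonormal ones: they may contain zero vectors and are
stable under contractions and under `C`, while `|⟨aᵢ, eₖ⟩| |⟨gᵢ, fₖ⟩|` is still doubly substochastic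
(`IsBessel.tsum_tsum_rpow_le`). -/

noncomputable section

/-! ### Bessel families and substochastic matrices -/

section Bessel

variable {H : Type u} [NormedAddCommGroup H] [InnerProductSpace ℂ H]

/-- A family of vectors which satisfies Bessel's inequality. -/
def IsBessel {κ : Type*} (e : κ → H) : Prop :=
  ∀ x, ∑' k, ‖⟪e k, x⟫_ℂ‖ₑ ^ 2 ≤ ‖x‖ₑ ^ 2

theorem enorm_inner_symm (x y : H) : ‖⟪x, y⟫_ℂ‖ₑ = ‖⟪y, x⟫_ℂ‖ₑ := by
  rw [← inner_conj_symm, RCLike.enorm_conj]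

theorem Orthonormal.isBessel {κ : Type*} {e : κ → H} (he : Orthonormal ℂ e) : IsBessel e :=
  tsum_enorm_inner_sq_le he

theorem IsBessel.comp {κ κ' : Type*} {e : κ → H} (he : IsBessel e) {r : κ' → κ}
    (hr : Function.Injective r) : IsBessel (e ∘ r) := fun x =>
  (ENNReal.tsum_comp_le_tsum_of_injective hr fun k => ‖⟪e k, x⟫_ℂ‖ₑ ^ 2).trans (he x)

/-- Bessel's inequality at `x = e k` gives `‖e k‖⁴ ≤ ‖e k‖²`. -/
theorem IsBessel.enorm_sq_le_one {κ : Type*} {e : κ → H} (he : IsBessel e) (k : κ) :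
    ‖e k‖ₑ ^ 2 ≤ 1 := by
  have h1 : ‖⟪e k, e k⟫_ℂ‖ₑ ^ 2 ≤ ‖e k‖ₑ ^ 2 :=
    (ENNReal.le_tsum (f := fun j => ‖⟪e j, e k⟫_ℂ‖ₑ ^ 2) k).trans (he (e k))
  rw [inner_self_eq_norm_sq_to_K, ← ofReal_norm, ← ofReal_norm, ← ENNReal.ofReal_pow (by positivity),
    ← ENNReal.ofReal_pow (by positivity), ENNReal.ofReal_le_ofReal_iff (by positivity)] at h1
  rw [← ofReal_norm, ← ENNReal.ofReal_pow (by positivity), ← ENNReal.ofReal_one,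
    ENNReal.ofReal_le_ofReal_iff (by positivity)]
  simp only [norm_pow, Complex.coe_algebraMap, Complex.norm_real, norm_norm] at h1
  by_contra! h
  nlinarith

theorem enorm_apply_le_of_norm_le_one {H' : Type*} [NormedAddCommGroup H'] [NormedSpace ℂ H']
    {A : H →L[ℂ] H'} (hA : ‖A‖ ≤ 1) (x : H) : ‖A x‖ₑ ≤ ‖x‖ₑ := by
  rw [← ofReal_norm, ← ofReal_norm]
  exact ENNReal.ofReal_le_ofReal (A.le_of_opNorm_le_of_le hA le_rfl |>.trans (by simp))

theorem IsBessel.map [CompleteSpace H] {κ : Type*} {e : κ → H} (he : IsBessel e) {A : H →L[ℂ] H}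
    (hA : ‖A‖ ≤ 1) : IsBessel fun k => A (e k) := by
  intro x
  simp_rw [← ContinuousLinearMap.adjoint_inner_right A]
  refine (he _).trans ?_
  gcongr
  exact enorm_apply_le_of_norm_le_one (by rwa [LinearIsometryEquiv.norm_map]) x

theorem IsConjugation.inner_apply_left {C : H →ₛₗ[starRingEnd ℂ] H} (hC : IsConjugation C)
    (x y : H) : ⟪C x, y⟫_ℂ = ⟪C y, x⟫_ℂ := by
  rw [← hC.inner_map_map x (C y), hC.involutive]

theorem IsConjugation.inner_apply_right {C : H →ₛₗ[starRingEnd ℂ] H} (hC : IsConjugation C)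
    (x y : H) : ⟪x, C y⟫_ℂ = ⟪y, C x⟫_ℂ := by
  rw [← inner_conj_symm, hC.inner_apply_left, inner_conj_symm]

theorem IsConjugation.norm_map {C : H →ₛₗ[starRingEnd ℂ] H} (hC : IsConjugation C)
    (x : H) : ‖C x‖ = ‖x‖ := by
  have h := hC.inner_map_map x x
  rw [inner_self_eq_norm_sq_to_K, inner_self_eq_norm_sq_to_K] at h
  have h' : ‖C x‖ ^ 2 = ‖x‖ ^ 2 := by exact_mod_cast h
  exact (sq_eq_sq₀ (norm_nonneg _) (norm_nonneg _)).1 h'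

theorem IsBessel.conj {κ : Type*} {e : κ → H} (he : IsBessel e) {C : H →ₛₗ[starRingEnd ℂ] H}
    (hC : IsConjugation C) : IsBessel fun k => C (e k) := by
  intro x
  simp_rw [hC.inner_apply_left (e _) x, enorm_inner_symm (C x)]
  refine (he _).trans ?_
  rw [← ofReal_norm, ← ofReal_norm, hC.norm_map]

theorem ENNReal.mul_le_half_sq_add_sq {x y : ℝ≥0∞} (hx : x ≠ ∞) (hy : y ≠ ∞) :
    x * y ≤ 2⁻¹ * (x ^ 2 + y ^ 2) := by
  lift x to NNReal using hx
  lift y to NNReal using hy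
  have h : 2 * x * y ≤ x ^ 2 + y ^ 2 := two_mul_le_add_sq _ _
  have h' : (2 : ℝ≥0∞) * ((x : ℝ≥0∞) * y) ≤ x ^ 2 + y ^ 2 := by
    rw [← mul_assoc]
    exact_mod_cast h
  calc (x : ℝ≥0∞) * y = 2⁻¹ * (2 * (x * y)) := by
        rw [← mul_assoc, ENNReal.inv_mul_cancel (by norm_num) (by norm_num), one_mul]
    _ ≤ _ := by gcongr

theorem ENNReal.half_mul_add_le_one {x y : ℝ≥0∞} (hx : x ≤ 1) (hy : y ≤ 1) :
    2⁻¹ * (x + y) ≤ 1 := by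
  calc 2⁻¹ * (x + y) ≤ 2⁻¹ * (1 + 1) := by gcongr
    _ = 1 := by rw [one_add_one_eq_two, ENNReal.inv_mul_cancel (by norm_num) (by norm_num)]

/-- By the arithmetic-geometric mean inequality each product is at most half a sum of squares, and
Bessel's inequality bounds both sums of squares by one. This serves for the rows and for the columns
of the substochastic matrix. -/
theorem IsBessel.tsum_mul_le_one {ι : Type*} {a g : ι → H} (ha : IsBessel a) (hg : IsBessel g)
    {x y : H} (hx : ‖x‖ₑ ^ 2 ≤ 1) (hy : ‖y‖ₑ ^ 2 ≤ 1) :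
    ∑' i, ‖⟪a i, x⟫_ℂ‖ₑ * ‖⟪g i, y⟫_ℂ‖ₑ ≤ 1 := by
  calc ∑' i, ‖⟪a i, x⟫_ℂ‖ₑ * ‖⟪g i, y⟫_ℂ‖ₑ
      ≤ ∑' i, 2⁻¹ * (‖⟪a i, x⟫_ℂ‖ₑ ^ 2 + ‖⟪g i, y⟫_ℂ‖ₑ ^ 2) :=
        ENNReal.tsum_le_tsum fun i => ENNReal.mul_le_half_sq_add_sq enorm_ne_top enorm_ne_top
    _ ≤ 1 := by
        rw [ENNReal.tsum_mul_left, ENNReal.tsum_add]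
        exact ENNReal.half_mul_add_le_one ((ha x).trans hx) ((hg y).trans hy)

/-- The matrix `|⟨aᵢ, eₖ⟩| |⟨gᵢ, fₖ⟩|` is doubly substochastic, hence contracts `ℓᵖ`. -/
theorem IsBessel.tsum_tsum_rpow_le {p : ℝ} (hp : 1 ≤ p) {κ ι : Type*} {e f : κ → H} {a g : ι → H}
    (he : IsBessel e) (hf : IsBessel f) (ha : IsBessel a) (hg : IsBessel g) (s : ι → ℝ≥0∞) :
    ∑' k, (∑' i, ‖⟪a i, e k⟫_ℂ‖ₑ * ‖⟪g i, f k⟫_ℂ‖ₑ * s i) ^ p ≤ ∑' i, s i ^ p := by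
  calc _ ≤ ∑' k, ∑' i, ‖⟪a i, e k⟫_ℂ‖ₑ * ‖⟪g i, f k⟫_ℂ‖ₑ * s i ^ p :=
        -- Jensen's inequality in each row, whose total mass is at most one.
        ENNReal.tsum_le_tsum fun k => tsum_mul_rpow_le hp _ _
          (ha.tsum_mul_le_one hg (he.enorm_sq_le_one k) (hf.enorm_sq_le_one k))
    _ = ∑' i, ∑' k, ‖⟪a i, e k⟫_ℂ‖ₑ * ‖⟪g i, f k⟫_ℂ‖ₑ * s i ^ p := ENNReal.tsum_comm
    _ ≤ ∑' i, 1 * s i ^ p := by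
        refine ENNReal.tsum_le_tsum fun i => ?_
        rw [ENNReal.tsum_mul_right]
        gcongr
        -- Column sums: the pairs `(a, g)` and `(e, f)` exchange roles.
        simp_rw [enorm_inner_symm (a i), enorm_inner_symm (g i)]
        exact he.tsum_mul_le_one hf (ha.enorm_sq_le_one i) (hg.enorm_sq_le_one i)
    _ = _ := by simp

theorem ContinuousLinearMap.opNorm_le_of_norm_inner_le {X : H →L[ℂ] H} {M : ℝ} (hM : 0 ≤ M)
    (h : ∀ x y : H, ‖x‖ = 1 → ‖y‖ = 1 → ‖⟪y, X x⟫_ℂ‖ ≤ M) : ‖X‖ ≤ M := by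
  refine X.opNorm_le_bound' hM fun x hx => ?_
  by_cases hX : ‖X x‖ = 0
  · rw [hX]; positivity
  have h1 := h ((‖x‖⁻¹ : ℂ) • x) ((‖X x‖⁻¹ : ℂ) • X x)
    (by simp [norm_smul, hx]) (by simp [norm_smul, hX])
  rw [map_smul, inner_smul_left, inner_smul_right, inner_self_eq_norm_sq_to_K] at h1
  simp only [norm_mul, norm_inv, RCLike.norm_conj, norm_pow, Complex.coe_algebraMap,
    Complex.norm_real, norm_norm] at h1
  field_simp at h1
  linarith

theorem sum_rankOne_apply {κ : Type*} [Fintype κ] (e f : κ → H) (c : κ → ℂ) (x : H) :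
    (∑ k, c k • InnerProductSpace.rankOne ℂ (e k) (f k)) x = ∑ k, (c k * ⟪f k, x⟫_ℂ) • e k := by
  simp [sum_apply, smul_smul]

theorem enorm_inner_sum_rankOne_le {κ : Type*} [Fintype κ] (e f : κ → H) (c : κ → ℂ) (x y : H) :
    ‖⟪y, (∑ k, c k • InnerProductSpace.rankOne ℂ (e k) (f k)) x⟫_ℂ‖ₑ ≤
      ∑' k, ‖⟪f k, x⟫_ℂ‖ₑ * ‖⟪e k, y⟫_ℂ‖ₑ * ‖c k‖ₑ := by
  rw [sum_rankOne_apply, inner_sum, tsum_fintype]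
  refine (enorm_sum_le _ _).trans (Finset.sum_le_sum fun k _ => le_of_eq ?_)
  rw [inner_smul_right, enorm_mul, enorm_mul, enorm_inner_symm y]
  ring

/-- The operator norm of `∑ₖ cₖ ⟨fₖ, ·⟩ eₖ` for Bessel families. -/
theorem IsBessel.norm_sum_rankOne_le {κ : Type*} [Fintype κ] {e f : κ → H} (he : IsBessel e)
    (hf : IsBessel f) {c : κ → ℂ} (hc : ∀ k, ‖c k‖ ≤ 1) :
    ‖∑ k, c k • InnerProductSpace.rankOne ℂ (e k) (f k)‖ ≤ 1 := by
  refine ContinuousLinearMap.opNorm_le_of_norm_inner_le zero_le_one fun x y hx hy => ?_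
  have unit : ∀ {x : H}, ‖x‖ = 1 → ‖x‖ₑ ^ 2 ≤ 1 := by
    intro x hx
    rw [← ofReal_norm, hx]; simp
  have h : ‖⟪y, (∑ k, c k • InnerProductSpace.rankOne ℂ (e k) (f k)) x⟫_ℂ‖ₑ ≤ 1 := by
    refine (enorm_inner_sum_rankOne_le e f c x y).trans ?_
    refine le_trans (ENNReal.tsum_le_tsum fun k => ?_) (hf.tsum_mul_le_one he (unit hx) (unit hy))
    refine mul_le_of_le_one_right' ?_
    rw [← ofReal_norm, ← ENNReal.ofReal_one]
    exact ENNReal.ofReal_le_ofReal (hc k)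
  rwa [← ofReal_norm, ← ENNReal.ofReal_one, ENNReal.ofReal_le_ofReal_iff zero_le_one] at h

theorem isCompactOperator_rankOne (x y : H) :
    IsCompactOperator (InnerProductSpace.rankOne ℂ x y) := by
  exact (isCompactOperator_of_locallyCompactSpace_dom (innerSL ℂ y)).clm_comp
    (ContinuousLinearMap.toSpanSingleton ℂ x)

theorem isCompactOperator_sum_rankOne {κ : Type*} [Fintype κ] (e f : κ → H) (c : κ → ℂ) :
    IsCompactOperator (∑ k, c k • InnerProductSpace.rankOne ℂ (e k) (f k) : H →L[ℂ] H) :=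
  Submodule.sum_mem (compactOperator (RingHom.id ℂ) H H) fun k _ =>
    Submodule.smul_mem _ _ (isCompactOperator_rankOne (e k) (f k))

variable [CompleteSpace H]

/-- A compact operator has a Hilbert basis `aᵢ` of eigenvectors of `T* T` and a Bessel family `gᵢ`
with `T aᵢ = ‖T aᵢ‖ gᵢ`. -/
theorem exists_singular_basis {T : H →L[ℂ] H} (hT : IsCompactOperator T) :
    ∃ (ι : Type u) (a : HilbertBasis ι ℂ H) (g : ι → H), IsBessel g ∧
      (∀ i, T (a i) = (‖T (a i)‖ : ℂ) • g i) ∧ (∀ i, ⟪g i, T (a i)⟫_ℂ = ‖T (a i)‖) ∧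
      ∀ i, (star T * T) (a i) = ((‖T (a i)‖ ^ 2 : ℝ) : ℂ) • a i := by
  obtain ⟨ι, a, ha⟩ := exists_eigenbasis hT
  -- Where `T aᵢ = 0` the inverse is `0` and so is `gᵢ`; the full family is Bessel, though it need
  -- not be orthonormal.
  refine ⟨ι, a, fun i => ((‖T (a i)‖⁻¹ : ℝ) : ℂ) • T (a i), ?_, ?_, ?_, ha⟩
  · intro x
    refine le_of_eq_of_le ?_ (tsum_enorm_inner_sq_le (orthonormal_normalize a ha) x)
    refine (tsum_subtype_eq_of_support_subset
      (f := fun i => ‖⟪((‖T (a i)‖⁻¹ : ℝ) : ℂ) • T (a i), x⟫_ℂ‖ₑ ^ 2)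
      (s := {i | T (a i) ≠ 0}) ?_).symm
    intro i hi h0
    exact hi (by simp [h0])
  · intro i
    by_cases h : T (a i) = 0
    · simp [h]
    · have : (‖T (a i)‖ : ℂ) ≠ 0 := by simpa using h
      simp [smul_smul, this]
  · intro i
    by_cases h : T (a i) = 0
    · simp [h]
    · have : (‖T (a i)‖ : ℂ) ≠ 0 := by simpa using h
      rw [inner_smul_left, inner_self_eq_norm_sq_to_K]
      simp only [Complex.ofReal_inv, map_inv₀, Complex.conj_ofReal, Complex.coe_algebraMap]
      field_simp

theorem one_le_toReal {p : ℝ≥0∞} (hp1 : 1 ≤ p) (hp : p ≠ ∞) : 1 ≤ p.toReal := by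
  simpa using ENNReal.toReal_mono hp hp1

/-- `∑ₖ |⟨fₖ, T eₖ⟩|^p ≤ ‖T‖ₚ^p` for all Bessel families. -/
theorem IsBessel.tsum_enorm_inner_le {p : ℝ≥0∞} (hp1 : 1 ≤ p) (hp : p ≠ ∞) {T : H →L[ℂ] H}
    (hT : IsCompactOperator T) {κ : Type*} {e f : κ → H} (he : IsBessel e) (hf : IsBessel f) :
    (∑' k, ‖⟪f k, T (e k)⟫_ℂ‖ₑ ^ p.toReal) ^ (1 / p.toReal) ≤ schattenENorm p T := by
  obtain ⟨ι, a, g, hg, hag, -, ha⟩ := exists_singular_basis hT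
  have h1 := one_le_toReal hp1 hp
  rw [schattenENorm_of_eigenbasis hp1 hp a ha]
  refine ENNReal.rpow_le_rpow (le_trans ?_
    (IsBessel.tsum_tsum_rpow_le h1 he hf a.orthonormal.isBessel hg _)) (by positivity)
  refine ENNReal.tsum_le_tsum fun k => ENNReal.rpow_le_rpow ?_ (by linarith)
  have h2 := ((a.hasSum_repr (e k)).mapL T).mapL (innerSL ℂ (f k))
  refine (enorm_tsum_le h2).trans (ENNReal.tsum_le_tsum fun i => ?_)
  simp only [map_smul, innerSL_apply_apply, smul_eq_mul, enorm_mul, a.repr_apply_apply]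
  conv_lhs => rw [hag i]
  rw [inner_smul_right, enorm_mul, enorm_inner_symm (f k), mul_assoc, mul_comm ‖⟪g i, f k⟫_ℂ‖ₑ]
  gcongr
  rw [← ofReal_norm, ← ofReal_norm]; simp

/-- The Schatten norm of `∑ₖ cₖ ⟨fₖ, ·⟩ eₖ` for Bessel families. -/
theorem IsBessel.schattenENorm_sum_rankOne_le {p : ℝ≥0∞} (hp1 : 1 ≤ p) (hp : p ≠ ∞)
    {κ : Type*} [Fintype κ] {e f : κ → H} (he : IsBessel e) (hf : IsBessel f) (c : κ → ℂ) :
    schattenENorm p (∑ k, c k • InnerProductSpace.rankOne ℂ (e k) (f k)) ≤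
      (∑ k, ‖c k‖ₑ ^ p.toReal) ^ (1 / p.toReal) := by
  have h1 := one_le_toReal hp1 hp
  obtain ⟨ι, a, g, hg, -, hga, ha⟩ := exists_singular_basis (isCompactOperator_sum_rankOne e f c)
  rw [schattenENorm_of_eigenbasis hp1 hp a ha]
  refine ENNReal.rpow_le_rpow ?_ (by positivity)
  refine le_trans ?_ ((IsBessel.tsum_tsum_rpow_le h1 a.orthonormal.isBessel hg hf he
    fun k => ‖c k‖ₑ).trans (tsum_fintype _).le)
  refine ENNReal.tsum_le_tsum fun i => ENNReal.rpow_le_rpow ?_ (by linarith)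
  -- The singular value at `aᵢ` equals the matrix entry of the sum at `(gᵢ, aᵢ)`, so the
  -- substochastic estimate applies with `|cₖ|` as the input sequence.
  refine le_trans (le_of_eq ?_) (enorm_inner_sum_rankOne_le e f c (a i) (g i))
  rw [hga, ← ofReal_norm, ← ofReal_norm]
  simp

end Bessel

/-! ### Finite rank approximation, the trace and Hölder's inequality -/

section Trace

variable {H : Type u} [NormedAddCommGroup H] [InnerProductSpace ℂ H]

/-- The span of the operators of rank one: the operators of finite rank. -/
def finiteRank (H : Type u) [NormedAddCommGroup H] [InnerProductSpace ℂ H] :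
    Submodule ℂ (H →L[ℂ] H) :=
  Submodule.span ℂ (Set.range fun v : H × H => InnerProductSpace.rankOne ℂ v.1 v.2)

theorem rankOne_mem_finiteRank (x y : H) : InnerProductSpace.rankOne ℂ x y ∈ finiteRank H :=
  Submodule.subset_span ⟨(x, y), rfl⟩

theorem isCompactOperator_of_mem_finiteRank {X : H →L[ℂ] H} (hX : X ∈ finiteRank H) :
    IsCompactOperator X := by
  have h : finiteRank H ≤ compactOperator (RingHom.id ℂ) H H := by
    rw [finiteRank, Submodule.span_le]
    rintro _ ⟨v, rfl⟩
    exact isCompactOperator_rankOne v.1 v.2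
  exact h hX

theorem mul_starProjection_mem_finiteRank (U : Submodule ℂ H) [FiniteDimensional ℂ U]
    (X : H →L[ℂ] H) : X * U.starProjection ∈ finiteRank H := by
  rw [(stdOrthonormalBasis ℂ U).starProjection_eq_sum_rankOne, Finset.mul_sum]
  refine Submodule.sum_mem _ fun i _ => ?_
  rw [ContinuousLinearMap.mul_def, InnerProductSpace.comp_rankOne]
  exact rankOne_mem_finiteRank _ _

variable [CompleteSpace H]

theorem isCompactOperator_of_mem_closure_finiteRank {X : H →L[ℂ] H}
    (hX : X ∈ closure (finiteRank H : Set (H →L[ℂ] H))) : IsCompactOperator X :=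
  closure_minimal (fun _ h => isCompactOperator_of_mem_finiteRank h)
    isClosed_setOfPred_isCompactOperator hX

theorem starProjection_mul_mem_finiteRank (U : Submodule ℂ H) [FiniteDimensional ℂ U]
    (X : H →L[ℂ] H) : U.starProjection * X ∈ finiteRank H := by
  rw [(stdOrthonormalBasis ℂ U).starProjection_eq_sum_rankOne, Finset.sum_mul]
  refine Submodule.sum_mem _ fun i _ => ?_
  rw [ContinuousLinearMap.mul_def, InnerProductSpace.rankOne_comp]
  exact rankOne_mem_finiteRank _ _

/-- Compact operators are norm limits of operators of finite rank. -/
theorem IsCompactOperator.mem_closure_finiteRank {X : H →L[ℂ] H} (hX : IsCompactOperator X) :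
    X ∈ closure (finiteRank H : Set (H →L[ℂ] H)) := by
  rw [Metric.mem_closure_iff]
  intro ε hε
  have htb : TotallyBounded (X '' Metric.closedBall 0 1) :=
    ((IsCompactOperator.isCompact_closure_image_closedBall (f := (X : H →ₗ[ℂ] H)) hX
      1).totallyBounded).subset subset_closure
  -- Projecting onto the span of a finite `ε / 2`-net of the image of the unit ball moves no `X z`
  -- with `‖z‖ = 1` by more than `ε / 2`.
  obtain ⟨t, ht, hcov⟩ := Metric.totallyBounded_iff.1 htb (ε / 2) (by positivity)
  let U : Submodule ℂ H := Submodule.span ℂ t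
  have : FiniteDimensional ℂ U := FiniteDimensional.span_of_finite ℂ ht
  refine ⟨U.starProjection * X, starProjection_mul_mem_finiteRank U X, ?_⟩
  rw [dist_eq_norm]
  refine lt_of_le_of_lt (ContinuousLinearMap.opNorm_le_of_unit_norm (C := ε / 2) (by positivity)
    fun z hz => ?_) (half_lt_self hε)
  have hz' : X z ∈ ⋃ y ∈ t, Metric.ball y (ε / 2) := hcov ⟨z, by simp [hz], rfl⟩
  simp only [Set.mem_iUnion, Metric.mem_ball, exists_prop] at hz'
  obtain ⟨y, hy, hzy⟩ := hz'
  rw [dist_eq_norm] at hzy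
  change ‖X z - U.starProjection (X z)‖ ≤ ε / 2
  rw [Submodule.starProjection_minimal]
  exact (ciInf_le ⟨0, by rintro _ ⟨w, rfl⟩; exact norm_nonneg _⟩
    (⟨y, Submodule.subset_span hy⟩ : U)).trans hzy.le

/-- The trace, with respect to the standard basis. -/
def opTrace (A : H →L[ℂ] H) : ℂ := ∑' i, ⟪stdBasis H i, A (stdBasis H i)⟫_ℂ

theorem HasTrace.opTrace_eq {A : H →L[ℂ] H} {z : ℂ} (h : HasTrace A z) : opTrace A = z :=
  (h.2 _ (stdBasis H)).tsum_eq

theorem summable_of_tsum_enorm_ne_top {ι : Type*} {f : ι → ℂ} (h : ∑' i, ‖f i‖ₑ ≠ ∞) :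
    Summable f := by
  refine Summable.of_nnnorm ?_
  rw [← ENNReal.tsum_coe_ne_top_iff_summable]
  simpa [enorm_eq_nnnorm] using h

theorem schattenENorm_one_of_eigenbasis {T : H →L[ℂ] H} {ι : Type*} (a : HilbertBasis ι ℂ H)
    (ha : ∀ i, (star T * T) (a i) = ((‖T (a i)‖ ^ 2 : ℝ) : ℂ) • a i) :
    schattenENorm 1 T = ∑' i, ‖T (a i)‖ₑ := by
  simpa using schattenENorm_of_eigenbasis le_rfl ENNReal.one_ne_top a ha

/-- Expanding in a singular basis `a` and in an arbitrary basis `b` gives the double family `⟨aᵢ,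
bₖ⟩ ⟨bₖ, A aᵢ⟩`, absolutely summable because the singular values are. Summing over `k` first yields
the trace in `a`, over `i` first the trace in `b`. -/
theorem exists_hasTrace {A : H →L[ℂ] H} (hA : A ∈ schattenClass H 1) : ∃ z, HasTrace A z := by
  obtain ⟨ι, a, g, hg, hag, -, ha⟩ := exists_singular_basis hA.1
  have hsum : ∑' i, ‖A (a i)‖ₑ < ∞ := schattenENorm_one_of_eigenbasis a ha ▸ hA.2
  refine ⟨∑' i, ⟪a i, A (a i)⟫_ℂ, hA, fun κ b => ?_⟩
  let F : ι × κ → ℂ := fun x => ⟪a x.1, b x.2⟫_ℂ * ⟪b x.2, A (a x.1)⟫_ℂ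
  have hF : Summable F := by
    refine summable_of_tsum_enorm_ne_top (ne_top_of_le_ne_top hsum.ne ?_)
    rw [ENNReal.tsum_prod']
    refine ENNReal.tsum_le_tsum fun i => ?_
    have h1 : ∀ k, ‖F (i, k)‖ₑ = ‖A (a i)‖ₑ * (‖⟪b k, a i⟫_ℂ‖ₑ * ‖⟪b k, g i⟫_ℂ‖ₑ) := by
      intro k
      simp only [F]
      conv_lhs => rw [hag i]
      rw [inner_smul_right, enorm_mul, enorm_mul, enorm_inner_symm (a i), ← ofReal_norm (A (a i)),
        ← ofReal_norm (‖A (a i)‖ : ℂ)]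
      simp only [Complex.norm_real, norm_norm]
      ring
    simp_rw [h1]
    rw [ENNReal.tsum_mul_left]
    exact mul_le_of_le_one_right' (b.orthonormal.isBessel.tsum_mul_le_one b.orthonormal.isBessel
      (a.orthonormal.isBessel.enorm_sq_le_one i) (hg.enorm_sq_le_one i))
  have h1 : HasSum (fun i => ⟪a i, A (a i)⟫_ℂ) (∑' x, F x) :=
    hF.hasSum.prod_fiberwise fun i => b.hasSum_inner_mul_inner (a i) (A (a i))
  have h2 : HasSum (fun k => ⟪b k, A (b k)⟫_ℂ) (∑' x, F x) := by
    have h3 : HasSum (F ∘ Prod.swap) (∑' x, F x) :=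
      (Equiv.prodComm κ ι).hasSum_iff.2 hF.hasSum
    refine h3.prod_fiberwise fun k => ?_
    have h4 := ((a.hasSum_repr (b k)).mapL A).mapL (innerSL ℂ (b k))
    simp only [map_smul, innerSL_apply_apply, smul_eq_mul, a.repr_apply_apply] at h4
    exact h4
  rwa [h1.tsum_eq]

theorem hasTrace_opTrace {A : H →L[ℂ] H} (hA : A ∈ schattenClass H 1) :
    HasTrace A (opTrace A) := by
  obtain ⟨z, hz⟩ := exists_hasTrace hA
  rwa [hz.opTrace_eq]

theorem enorm_opTrace_le {A : H →L[ℂ] H} (hA : A ∈ schattenClass H 1) :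
    ‖opTrace A‖ₑ ≤ schattenENorm 1 A := by
  refine (enorm_tsum_le ((hasTrace_opTrace hA).2 _ (stdBasis H))).trans ?_
  simpa using (stdBasis H).orthonormal.isBessel.tsum_enorm_inner_le le_rfl ENNReal.one_ne_top hA.1
    (stdBasis H).orthonormal.isBessel

theorem opTrace_add {A B : H →L[ℂ] H} (hA : A ∈ schattenClass H 1) (hB : B ∈ schattenClass H 1) :
    opTrace (A + B) = opTrace A + opTrace B := by
  refine HasSum.tsum_eq ?_
  simpa [inner_add_right] using
    ((hasTrace_opTrace hA).2 _ (stdBasis H)).add ((hasTrace_opTrace hB).2 _ (stdBasis H))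

theorem opTrace_smul (c : ℂ) (A : H →L[ℂ] H) : opTrace (c • A) = c * opTrace A := by
  simp [opTrace, tsum_mul_left]

/-- Parseval's identity. It lets a trace functional recover the matrix entries of its operator. -/
theorem opTrace_rankOne_mul (x y : H) (T : H →L[ℂ] H) :
    opTrace (InnerProductSpace.rankOne ℂ x y * T) = ⟪y, T x⟫_ℂ := by
  refine HasSum.tsum_eq ?_
  rw [← ContinuousLinearMap.adjoint_inner_left]
  refine ((stdBasis H).hasSum_inner_mul_inner (ContinuousLinearMap.adjoint T y) x).congr_fun ?_
  intro i
  rw [mul_apply_eq_comp, InnerProductSpace.rankOne_apply, inner_smul_right,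
    ContinuousLinearMap.adjoint_inner_left]

theorem exists_smul_norm_le_one (A : H →L[ℂ] H) :
    ∃ B : H →L[ℂ] H, ‖B‖ ≤ 1 ∧ A = (‖A‖ : ℂ) • B := by
  by_cases h : ‖A‖ = 0
  · exact ⟨0, by simp, by simpa using h⟩
  · refine ⟨(‖A‖⁻¹ : ℂ) • A, ?_, ?_⟩
    · simp [norm_smul, h]
    · rw [smul_smul, mul_inv_cancel₀ (by exact_mod_cast h), one_smul]

/-- Since `⟨gᵢ, A T B aᵢ⟩ = ⟨A* gᵢ, T (B aᵢ)⟩`, the contractions are absorbed into the two Bessel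
families. -/
theorem schattenENorm_one_mul_mul_le_of_norm_le_one {A T B : H →L[ℂ] H} (hT : IsCompactOperator T)
    (hA : ‖A‖ ≤ 1) (hB : ‖B‖ ≤ 1) : schattenENorm 1 (A * T * B) ≤ schattenENorm 1 T := by
  obtain ⟨ι, a, g, hg, -, hga, ha⟩ :=
    exists_singular_basis (T := A * T * B) ((hT.clm_comp A).comp_clm B)
  rw [schattenENorm_one_of_eigenbasis a ha]
  have h := (a.orthonormal.isBessel.map hB).tsum_enorm_inner_le le_rfl ENNReal.one_ne_top hT
    (hg.map (A := ContinuousLinearMap.adjoint A) (by rwa [LinearIsometryEquiv.norm_map]))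
  simp only [ENNReal.toReal_one, ENNReal.rpow_one, div_one] at h
  refine le_trans (le_of_eq (tsum_congr fun i => ?_)) h
  rw [ContinuousLinearMap.adjoint_inner_left]
  change _ = ‖⟪g i, (A * T * B) (a i)⟫_ℂ‖ₑ
  rw [hga, ← ofReal_norm, ← ofReal_norm]
  simp

theorem schattenENorm_one_mul_mul_le {T : H →L[ℂ] H} (hT : IsCompactOperator T)
    (A B : H →L[ℂ] H) :
    schattenENorm 1 (A * T * B) ≤ ‖A‖ₑ * schattenENorm 1 T * ‖B‖ₑ := by
  obtain ⟨A', hA', hA⟩ := exists_smul_norm_le_one A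
  obtain ⟨B', hB', hB⟩ := exists_smul_norm_le_one B
  have h : A * T * B = ((‖A‖ : ℂ) * ‖B‖) • (A' * T * B') := by
    conv_lhs => rw [hA, hB]
    simp only [smul_mul_assoc, mul_smul_comm, smul_smul, mul_comm]
  have hn : ∀ X : H →L[ℂ] H, ‖(‖X‖ : ℂ)‖ₑ = ‖X‖ₑ := fun X => by
    rw [← ofReal_norm, ← ofReal_norm]; simp
  rw [h, schattenENorm_smul le_rfl _ ((hT.clm_comp A').comp_clm B' :
    IsCompactOperator (A' * T * B')), enorm_mul, hn, hn, mul_right_comm]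
  gcongr
  exact schattenENorm_one_mul_mul_le_of_norm_le_one hT hA' hB'

theorem ENNReal.tsum_mul_le_Lp_mul_Lq {ι : Type*} {p q : ℝ} (hpq : p.HolderConjugate q)
    (f g : ι → ℝ≥0∞) :
    ∑' i, f i * g i ≤ (∑' i, f i ^ p) ^ (1 / p) * (∑' i, g i ^ q) ^ (1 / q) := by
  have := hpq.pos
  have := hpq.symm.pos
  rw [ENNReal.tsum_eq_iSup_sum]
  refine iSup_le fun s => (ENNReal.inner_le_Lp_mul_Lq s f g hpq).trans ?_
  gcongr <;> exact ENNReal.sum_le_tsum s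

/-- Hölder's inequality for Schatten norms. -/
theorem schattenENorm_one_mul_le {p q : ℝ≥0∞} (hp1 : 1 ≤ p) (hp : p ≠ ∞) (hq1 : 1 ≤ q)
    (hq : q ≠ ∞) (hpq : p.toReal.HolderConjugate q.toReal) {X T : H →L[ℂ] H}
    (hX : IsCompactOperator X) (hT : IsCompactOperator T) :
    schattenENorm 1 (X * T) ≤ schattenENorm q X * schattenENorm p T := by
  obtain ⟨ι, a, g, hg, -, hga, ha⟩ := exists_singular_basis (T := X * T) (hT.clm_comp X)
  obtain ⟨κ, c, v, hv, hcv, -, hc⟩ := exists_singular_basis hT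
  rw [schattenENorm_one_of_eigenbasis a ha, ENNReal.tsum_eq_iSup_sum]
  refine iSup_le fun s => ?_
  -- The contraction `W` sends `aᵢ` to `gᵢ` for `i ∈ s`, so the partial sum of singular values is
  -- `tr (W* X T)`. Computed in a singular basis `c` of `T`, with `T cₖ = ‖T cₖ‖ vₖ`, its terms are
  -- `‖T cₖ‖ ⟨W cₖ, X vₖ⟩`, where both `W cₖ` and `vₖ` are Bessel; the scalar Hölder inequality
  -- finishes.
  let W : H →L[ℂ] H := ∑ i : s, (1 : ℂ) • InnerProductSpace.rankOne ℂ (g i) (a i)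
  have hW : ‖W‖ ≤ 1 := IsBessel.norm_sum_rankOne_le (hg.comp Subtype.val_injective)
    (a.orthonormal.isBessel.comp Subtype.val_injective) (by simp)
  have hWc := c.orthonormal.isBessel.map hW
  have h1 : HasSum (fun k => ⟪W (c k), X (T (c k))⟫_ℂ) (∑ i : s, (‖(X * T) (a i)‖ : ℂ)) := by
    have h2 : ∀ i : s, HasSum (fun k => ⟪c k, a i⟫_ℂ * ⟪g i, X (T (c k))⟫_ℂ)
        (‖(X * T) (a i)‖ : ℂ) := by
      intro i
      have h3 := ((c.hasSum_repr (a i)).mapL (X * T)).mapL (innerSL ℂ (g i))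
      rw [innerSL_apply_apply, hga] at h3
      simp only [map_smul, innerSL_apply_apply, smul_eq_mul, c.repr_apply_apply] at h3
      exact h3
    convert hasSum_sum (s := Finset.univ) fun i _ => h2 i using 2 with k
    rw [sum_rankOne_apply, sum_inner]
    refine Finset.sum_congr rfl fun i _ => ?_
    rw [inner_smul_left, one_mul, inner_conj_symm]
  have h4 : ∑ i ∈ s, ‖(X * T) (a i)‖ₑ = ‖∑ i : s, (‖(X * T) (a i)‖ : ℂ)‖ₑ := by
    rw [← Complex.ofReal_sum, ← ofReal_norm, Complex.norm_real,
      Real.norm_of_nonneg (by positivity), ENNReal.ofReal_sum_of_nonneg (fun _ _ => norm_nonneg _),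
      Finset.sum_coe_sort s fun i => ENNReal.ofReal ‖(X * T) (a i)‖]
    simp
  rw [h4]
  calc _ ≤ ∑' k, ‖⟪W (c k), X (T (c k))⟫_ℂ‖ₑ := enorm_tsum_le h1
    _ = ∑' k, ‖T (c k)‖ₑ * ‖⟪W (c k), X (v k)⟫_ℂ‖ₑ := by
        refine tsum_congr fun k => ?_
        conv_lhs => rw [hcv k]
        rw [map_smul, inner_smul_right, enorm_mul]
        congr 1
        rw [← ofReal_norm, ← ofReal_norm]; simp
    _ ≤ _ := ENNReal.tsum_mul_le_Lp_mul_Lq hpq _ _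
    _ ≤ _ := by
        rw [mul_comm, schattenENorm_of_eigenbasis hp1 hp c hc]
        gcongr
        exact hv.tsum_enorm_inner_le hq1 hq hX hWc

end Trace

/-! ### Density of finite rank operators and functionals on Schatten spaces -/

section Density

variable {H : Type u} [NormedAddCommGroup H] [InnerProductSpace ℂ H]

theorem isBessel_unit {x : H} (hx : ‖x‖ ≤ 1) : IsBessel fun _ : Unit => x := by
  intro z
  rw [tsum_fintype, Fintype.sum_unique]
  gcongr
  rw [← ofReal_norm, ← ofReal_norm]
  refine ENNReal.ofReal_le_ofReal ((norm_inner_le_norm x z).trans ?_)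
  exact mul_le_of_le_one_left (norm_nonneg z) hx

theorem exists_smul_vector_norm_le_one (x : H) : ∃ y : H, ‖y‖ ≤ 1 ∧ x = (‖x‖ : ℂ) • y := by
  by_cases h : ‖x‖ = 0
  · exact ⟨0, by simp, by simpa using h⟩
  · refine ⟨(‖x‖⁻¹ : ℂ) • x, ?_, ?_⟩
    · simp [norm_smul, h]
    · rw [smul_smul, mul_inv_cancel₀ (by exact_mod_cast h), one_smul]

variable [CompleteSpace H]

theorem schattenENorm_top (T : H →L[ℂ] H) : schattenENorm ∞ T = ‖T‖ₑ := by
  simp [schattenENorm]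

theorem schattenENorm_rankOne_le {p : ℝ≥0∞} (hp1 : 1 ≤ p) (x y : H) :
    schattenENorm p (InnerProductSpace.rankOne ℂ x y) ≤ ‖x‖ₑ * ‖y‖ₑ := by
  by_cases hp : p = ∞
  · rw [hp, schattenENorm_top, InnerProductSpace.enorm_rankOne]
  have hp0 : 0 < p.toReal := by linarith [one_le_toReal hp1 hp]
  obtain ⟨x', hx', hx⟩ := exists_smul_vector_norm_le_one x
  obtain ⟨y', hy', hy⟩ := exists_smul_vector_norm_le_one y
  have h := (isBessel_unit hx').schattenENorm_sum_rankOne_le hp1 hp (isBessel_unit hy')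
    fun _ => (‖x‖ : ℂ) * ‖y‖
  rw [Fintype.sum_unique, Fintype.sum_unique, one_div, ENNReal.rpow_rpow_inv hp0.ne'] at h
  convert h using 1
  · conv_lhs => rw [hx, hy]
    congr 1
    ext z
    simp only [InnerProductSpace.rankOne_apply, smul_apply, inner_smul_left, smul_smul,
      Complex.conj_ofReal]
    congr 1
    ring
  · rw [enorm_mul]
    congr 1 <;> rw [← ofReal_norm, ← ofReal_norm] <;> simp

namespace SchattenSpace

variable {p : ℝ≥0∞} [Fact (1 ≤ p)]

/-- An operator in the Schatten class as an element of the Schatten space. -/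
def mk (T : H →L[ℂ] H) (hT : T ∈ schattenClass H p) : SchattenSpace H p := ⟨T, hT⟩

@[simp]
theorem toCLM_mk (T : H →L[ℂ] H) (hT : T ∈ schattenClass H p) : toCLM (mk T hT) = T := rfl

theorem toCLM_injective : Function.Injective (toCLM : SchattenSpace H p →ₗ[ℂ] H →L[ℂ] H) :=
  Subtype.val_injective

theorem enorm_def (T : SchattenSpace H p) : ‖T‖ₑ = schattenENorm p (toCLM T) := by
  rw [← ofReal_norm, norm_def, ENNReal.ofReal_toReal (toCLM_mem T).2.ne]

/-- Operators of rank one in the Schatten space. -/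
def rankOne (p : ℝ≥0∞) [Fact (1 ≤ p)] (x y : H) : SchattenSpace H p :=
  mk (InnerProductSpace.rankOne ℂ x y) ⟨isCompactOperator_rankOne x y,
    (schattenENorm_rankOne_le Fact.out x y).trans_lt (ENNReal.mul_lt_top enorm_lt_top enorm_lt_top)⟩

@[simp]
theorem toCLM_rankOne (x y : H) : toCLM (rankOne p x y) = InnerProductSpace.rankOne ℂ x y := rfl

theorem norm_rankOne_le (x y : H) : ‖rankOne p x y‖ ≤ ‖x‖ * ‖y‖ := by
  have h := schattenENorm_rankOne_le (Fact.out : 1 ≤ p) x y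
  rw [← toCLM_rankOne (p := p), ← enorm_def, ← ofReal_norm, ← ofReal_norm, ← ofReal_norm,
    ← ENNReal.ofReal_mul (norm_nonneg _), ENNReal.ofReal_le_ofReal_iff (by positivity)] at h
  exact h

theorem mem_of_toCLM_mem_finiteRank {K : Submodule ℂ (SchattenSpace H p)}
    (hK : ∀ x y, rankOne p x y ∈ K) {X : SchattenSpace H p} (hX : toCLM X ∈ finiteRank H) :
    X ∈ K := by
  have h : finiteRank H ≤ K.map toCLM := by
    rw [finiteRank, Submodule.span_le]
    rintro _ ⟨v, rfl⟩
    exact ⟨rankOne p v.1 v.2, hK _ _, rfl⟩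
  obtain ⟨Y, hY, hYX⟩ := h hX
  rwa [← toCLM_injective hYX]

theorem finiteRank_le_schattenClass : finiteRank H ≤ schattenClass H p := by
  rw [finiteRank, Submodule.span_le]
  rintro _ ⟨v, rfl⟩
  exact toCLM_mem (rankOne p v.1 v.2)

/-- For `p < ∞`, restrict `T` to the span of finitely many singular vectors. The remainder `T (1 -
P)` has the same eigenbasis, so the `p`-th power of its norm is a tail of the convergent series of
`‖T aᵢ‖^p`. -/
theorem exists_finiteRank_enorm_sub_lt (X : SchattenSpace H p) {ε : ℝ≥0∞} (hε : 0 < ε) :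
    ∃ F ∈ finiteRank H, schattenENorm p (toCLM X - F) < ε := by
  by_cases hp : p = ∞
  · subst hp
    obtain ⟨F, hF, h⟩ := EMetric.mem_closure_iff.1
      (toCLM_mem X).1.mem_closure_finiteRank ε hε
    refine ⟨F, hF, ?_⟩
    rwa [schattenENorm_top, ← edist_eq_enorm_sub]
  have hp1 : 1 ≤ p := Fact.out
  have hp0 : 0 < p.toReal := by linarith [one_le_toReal hp1 hp]
  set T := toCLM X with hT
  obtain ⟨ι, a, ha⟩ := exists_eigenbasis (toCLM_mem X).1
  rw [← hT] at ha
  have hfin : ∑' i, ‖T (a i)‖ₑ ^ p.toReal ≠ ∞ := by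
    intro h
    have h1 := (toCLM_mem X).2
    rw [schattenENorm_of_eigenbasis hp1 hp a ha, h, ENNReal.top_rpow_of_pos (by positivity)]
      at h1
    exact h1.ne rfl
  obtain ⟨s, hs⟩ := ((ENNReal.tendsto_tsum_compl_atTop_zero hfin).eventually_lt_const
    (ENNReal.rpow_pos_of_nonneg hε hp0.le)).exists
  let U : Submodule ℂ H := Submodule.span ℂ (a '' s)
  have : FiniteDimensional ℂ U := FiniteDimensional.span_of_finite ℂ (s.finite_toSet.image a)
  have hP1 : ∀ i ∈ s, U.starProjection (a i) = a i := fun i hi =>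
    Submodule.starProjection_eq_self_iff.2 (Submodule.subset_span ⟨i, hi, rfl⟩)
  have hP0 : ∀ i ∉ s, U.starProjection (a i) = 0 := by
    intro i hi
    rw [Submodule.starProjection_apply_eq_zero_iff, Submodule.mem_orthogonal]
    intro u hu
    refine Submodule.span_induction ?_ (by simp) ?_ ?_ hu
    · rintro _ ⟨j, hj, rfl⟩
      exact a.orthonormal.2 fun h => hi (h ▸ hj)
    · intro x y _ _ hx hy
      rw [inner_add_left, hx, hy, add_zero]
    · intro c x _ hx
      rw [inner_smul_left, hx, mul_zero]
  refine ⟨T * U.starProjection, mul_starProjection_mem_finiteRank U T, ?_⟩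
  set Y := T - T * U.starProjection with hY
  have hY1 : ∀ i ∈ s, Y (a i) = 0 := fun i hi => by simp [hY, hP1 i hi]
  have hY0 : ∀ i ∉ s, Y (a i) = T (a i) := fun i hi => by simp [hY, hP0 i hi]
  have hYs : ∀ x, star Y x = star T x - U.starProjection (star T x) := by
    intro x
    have hsa : star U.starProjection = U.starProjection := isSelfAdjoint_starProjection U
    rw [hY, star_sub, star_mul, hsa]
    rfl
  have hYa : ∀ i, (star Y * Y) (a i) = ((‖Y (a i)‖ ^ 2 : ℝ) : ℂ) • a i := by
    intro i
    rw [mul_apply_eq_comp]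
    by_cases hi : i ∈ s
    · simp [hY1 i hi]
    · rw [hY0 i hi, hYs, ← mul_apply_eq_comp, ha, map_smul, hP0 i hi, smul_zero, sub_zero]
  rw [schattenENorm_of_eigenbasis hp1 hp a hYa, one_div, ENNReal.rpow_inv_lt_iff hp0]
  refine lt_of_le_of_lt (le_of_eq ?_) hs
  rw [← tsum_subtype_eq_of_support_subset (f := fun i => ‖Y (a i)‖ₑ ^ p.toReal) (s := {i | i ∉ s})]
  · exact tsum_congr fun i => by rw [hY0 i i.2]
  · intro i hi his
    exact hi (by simp [hY1 i his, hp0])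

/-- Functionals on the Schatten space which agree on operators of rank one are equal. -/
theorem dual_ext {φ ψ : StrongDual ℂ (SchattenSpace H p)}
    (h : ∀ x y, φ (rankOne p x y) = ψ (rankOne p x y)) : φ = ψ := by
  ext X
  let K := LinearMap.ker ((φ - ψ : StrongDual ℂ (SchattenSpace H p)) : SchattenSpace H p →ₗ[ℂ] ℂ)
  have hK : IsClosed (K : Set (SchattenSpace H p)) :=
    ContinuousLinearMap.isClosed_ker (φ - ψ)
  have hX : X ∈ closure (K : Set (SchattenSpace H p)) := by
    rw [EMetric.mem_closure_iff]
    intro ε hε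
    obtain ⟨F, hF, hlt⟩ := exists_finiteRank_enorm_sub_lt X hε
    refine ⟨mk F (finiteRank_le_schattenClass hF), mem_of_toCLM_mem_finiteRank ?_ hF, ?_⟩
    · intro x y
      simp [K, h]
    · rwa [edist_eq_enorm_sub, enorm_def, map_sub, toCLM_mk]
  rw [hK.closure_eq] at hX
  simpa [K, sub_eq_zero] using hX

/-- The sesquilinear form of a functional on the Schatten space is given by an operator. -/
theorem exists_inner_eq_dual (φ : StrongDual ℂ (SchattenSpace H p)) :
    ∃ T : H →L[ℂ] H, ‖T‖ ≤ ‖φ‖ ∧ ∀ x y, φ (rankOne p x y) = ⟪y, T x⟫_ℂ := by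
  have hbound : ∀ x y, ‖φ (rankOne p x y)‖ ≤ ‖φ‖ * ‖y‖ * ‖x‖ := fun x y => by
    refine (φ.le_opNorm _).trans ?_
    rw [mul_assoc, mul_comm ‖y‖]
    gcongr
    exact norm_rankOne_le x y
  let B : H →L⋆[ℂ] H →L[ℂ] ℂ := LinearMap.mkContinuous₂
    (LinearMap.mk₂'ₛₗ (starRingEnd ℂ) (RingHom.id ℂ) (fun y x => φ (rankOne p x y))
      (fun y y' x => by
        rw [← map_add]; congr 1; exact toCLM_injective (by simp))
      (fun c y x => by
        rw [← map_smul]; congr 1; exact toCLM_injective (by simp))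
      (fun y x x' => by
        rw [← map_add]; congr 1; exact toCLM_injective (by simp))
      (fun c y x => by
        rw [← map_smul]; congr 1; exact toCLM_injective (by simp)))
    ‖φ‖ fun y x => hbound x y
  -- The form is conjugate-linear in `y`, so its representing operator acts on `y`; the adjoint
  -- moves it to `x`.
  have hB : ∀ x y, ⟪y, ContinuousLinearMap.adjoint
      (InnerProductSpace.continuousLinearMapOfBilin B) x⟫_ℂ = φ (rankOne p x y) := by
    intro x y
    rw [ContinuousLinearMap.adjoint_inner_right,
      InnerProductSpace.continuousLinearMapOfBilin_apply]
    rfl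
  refine ⟨_, ContinuousLinearMap.opNorm_le_of_norm_inner_le (norm_nonneg φ) fun x y hx hy => ?_,
    fun x y => (hB x y).symm⟩
  rw [hB]
  simpa [hx, hy] using hbound x y

/-- The functional `X ↦ tr (X T)`. -/
theorem exists_traceFunctional {T : H →L[ℂ] H} {M : ℝ≥0∞} (hM : M ≠ ∞)
    (h : ∀ X : SchattenSpace H p, schattenENorm 1 (toCLM X * T) ≤ ‖X‖ₑ * M) :
    ∃ φ : StrongDual ℂ (SchattenSpace H p), ‖φ‖ ≤ M.toReal ∧
      ∀ X, HasTrace (toCLM X * T) (φ X) := by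
  have hmem : ∀ X : SchattenSpace H p, toCLM X * T ∈ schattenClass H 1 := fun X =>
    ⟨(toCLM_mem X).1.comp_clm T,
      (h X).trans_lt (ENNReal.mul_lt_top enorm_lt_top hM.lt_top)⟩
  let φ : SchattenSpace H p →ₗ[ℂ] ℂ :=
    { toFun := fun X => opTrace (toCLM X * T)
      map_add' := fun X Y => by rw [map_add, add_mul, opTrace_add (hmem X) (hmem Y)]
      map_smul' := fun c X => by
        rw [map_smul, smul_mul_assoc, opTrace_smul]; rfl }
  have hφ : ∀ X, ‖φ X‖ ≤ M.toReal * ‖X‖ := by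
    intro X
    have h1 := (enorm_opTrace_le (hmem X)).trans (h X)
    have h2 := ENNReal.toReal_mono (ENNReal.mul_ne_top enorm_ne_top hM) h1
    rw [toReal_enorm, ENNReal.toReal_mul, toReal_enorm, mul_comm] at h2
    exact h2
  exact ⟨φ.mkContinuous _ hφ, φ.mkContinuous_norm_le ENNReal.toReal_nonneg hφ,
    fun X => hasTrace_opTrace (hmem X)⟩

end SchattenSpace

end Density

/-! ### A compactness criterion -/

section Compactness

variable {H : Type u} [NormedAddCommGroup H] [InnerProductSpace ℂ H]

theorem Orthonormal.fin_cons {n : ℕ} {e : Fin n → H} (he : Orthonormal ℂ e) {x : H}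
    (hx : ‖x‖ = 1) (hxe : ∀ i, ⟪e i, x⟫_ℂ = 0) :
    Orthonormal ℂ (Fin.cons x e : Fin (n + 1) → H) := by
  constructor
  · refine Fin.cases ?_ ?_
    · simpa using hx
    · intro i
      simpa using he.1 i
  · intro i j
    refine Fin.cases ?_ (fun i => ?_) i <;> refine Fin.cases ?_ (fun j => ?_) j
    · simp
    · intro _
      simpa using inner_eq_zero_symm.1 (hxe j)
    · intro _
      simpa using hxe i
    · intro hij
      simpa using he.2 fun h => hij (by rw [h])

variable [CompleteSpace H]

/-- An operator with uniformly bounded sums `∑ₖ |⟨fₖ, T eₖ⟩|^r` is compact. -/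
theorem isCompactOperator_of_sum_enorm_inner_le {T : H →L[ℂ] H} {r : ℝ} (hr : 0 < r) {M : ℝ≥0∞}
    (hM : M ≠ ∞)
    (h : ∀ (n : ℕ) (e f : Fin n → H), Orthonormal ℂ e → Orthonormal ℂ f →
      ∑ k, ‖⟪f k, T (e k)⟫_ℂ‖ₑ ^ r ≤ M) :
    IsCompactOperator T := by
  refine isCompactOperator_of_mem_closure_finiteRank (Metric.mem_closure_iff.2 fun ε hε => ?_)
  set δ : ℝ := ε / 2 with hδ
  have hδ0 : 0 < δ := by positivity
  let S : Set ℝ≥0∞ := {v | ∃ (n : ℕ) (e f : Fin n → H), Orthonormal ℂ e ∧ Orthonormal ℂ f ∧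
    v = ∑ k, ‖⟪f k, T (e k)⟫_ℂ‖ₑ ^ r}
  have hSM : sSup S ≤ M := by
    refine sSup_le ?_
    rintro _ ⟨n, e, f, he, hf, rfl⟩
    exact h n e f he hf
  have hSfin : sSup S ≠ ∞ := ne_top_of_le_ne_top hM hSM
  have h0S : (0 : ℝ≥0∞) ∈ S := ⟨0, Fin.elim0, Fin.elim0, ⟨fun i => i.elim0, fun i => i.elim0⟩,
    ⟨fun i => i.elim0, fun i => i.elim0⟩, by simp⟩
  have hδr : 0 < ENNReal.ofReal δ ^ r :=
    ENNReal.rpow_pos (ENNReal.ofReal_pos.2 hδ0) ENNReal.ofReal_ne_top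
  -- Take a pair of families whose sum is within `δ^r` of the supremum. Adjoining unit vectors `x ⊥
  -- e` and `y ⊥ f` with `|⟨y, T x⟩| > δ` would exceed the supremum.
  obtain ⟨v, hvS, hv⟩ : ∃ v ∈ S, sSup S < v + ENNReal.ofReal δ ^ r := by
    by_contra! hcon
    have h1 : sSup S ≤ sSup S - ENNReal.ofReal δ ^ r :=
      sSup_le fun v hv => ENNReal.le_sub_of_add_le_right
        (ENNReal.rpow_ne_top_of_nonneg hr.le ENNReal.ofReal_ne_top) (hcon v hv)
    have h2 : sSup S ≠ 0 := fun h2 => by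
      have h3 := hcon 0 h0S
      rw [h2, zero_add] at h3
      exact absurd h3 (not_le.2 hδr)
    exact absurd h1 (not_le.2 (ENNReal.sub_lt_self hSfin h2 hδr.ne'))
  obtain ⟨n, e, f, he, hf, rfl⟩ := hvS
  have key : ∀ x y : H, ‖x‖ = 1 → ‖y‖ = 1 → (∀ i, ⟪e i, x⟫_ℂ = 0) → (∀ i, ⟪f i, y⟫_ℂ = 0) →
      ‖⟪y, T x⟫_ℂ‖ ≤ δ := by
    intro x y hx hy hxe hyf
    by_contra! hlt
    have hmem : ∑ k, ‖⟪(Fin.cons y f : Fin (n + 1) → H) k,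
        T ((Fin.cons x e : Fin (n + 1) → H) k)⟫_ℂ‖ₑ ^ r ∈ S :=
      ⟨n + 1, _, _, he.fin_cons hx hxe, hf.fin_cons hy hyf, rfl⟩
    have hle := le_sSup hmem
    rw [Fin.sum_univ_succ] at hle
    simp only [Fin.cons_zero, Fin.cons_succ] at hle
    refine absurd hv (not_lt.2 (le_trans ?_ hle))
    rw [add_comm]
    gcongr
    rw [← ofReal_norm]
    exact ENNReal.ofReal_le_ofReal hlt.le
  let U : Submodule ℂ H := Submodule.span ℂ (Set.range e)
  let V : Submodule ℂ H := Submodule.span ℂ (Set.range f)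
  have : FiniteDimensional ℂ U := FiniteDimensional.span_of_finite ℂ (Set.finite_range e)
  have : FiniteDimensional ℂ V := FiniteDimensional.span_of_finite ℂ (Set.finite_range f)
  have key' : ∀ x ∈ Uᗮ, ∀ y ∈ Vᗮ, ‖⟪y, T x⟫_ℂ‖ ≤ δ * ‖y‖ * ‖x‖ := by
    intro x hx y hy
    by_cases hx0 : ‖x‖ = 0
    · rw [norm_eq_zero.1 hx0]; simp
    by_cases hy0 : ‖y‖ = 0
    · rw [norm_eq_zero.1 hy0]; simp
    have h1 := key ((‖x‖⁻¹ : ℂ) • x) ((‖y‖⁻¹ : ℂ) • y) (by simp [norm_smul, hx0])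
      (by simp [norm_smul, hy0])
      (fun i => (Submodule.mem_orthogonal _ _).1 (Submodule.smul_mem _ _ hx) _
        (Submodule.subset_span ⟨i, rfl⟩))
      (fun i => (Submodule.mem_orthogonal _ _).1 (Submodule.smul_mem _ _ hy) _
        (Submodule.subset_span ⟨i, rfl⟩))
    rw [map_smul, inner_smul_left, inner_smul_right] at h1
    simp only [norm_mul, norm_inv, RCLike.norm_conj, Complex.norm_real, norm_norm] at h1
    have hx1 : 0 < ‖x‖ := lt_of_le_of_ne (norm_nonneg _) (Ne.symm hx0)
    have hy1 : 0 < ‖y‖ := lt_of_le_of_ne (norm_nonneg _) (Ne.symm hy0)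
    calc ‖⟪y, T x⟫_ℂ‖ = (‖y‖⁻¹ * (‖x‖⁻¹ * ‖⟪y, T x⟫_ℂ‖)) * ‖y‖ * ‖x‖ := by field_simp
      _ ≤ _ := by gcongr
  -- With `P`, `Q` the projections onto `U`, `V`, subtracting this finite rank operator from `T`
  -- leaves `(1 - Q) T (1 - P)`, which `key'` bounds by `δ`.
  refine ⟨V.starProjection * T + (T - V.starProjection * T) * U.starProjection,
    Submodule.add_mem _ (starProjection_mul_mem_finiteRank V T)
      (mul_starProjection_mem_finiteRank U _), ?_⟩
  rw [dist_eq_norm]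
  refine lt_of_le_of_lt (ContinuousLinearMap.opNorm_le_of_norm_inner_le hδ0.le
    fun x y hx hy => ?_) (half_lt_self hε)
  have hsa : ∀ w : H, ⟪y, w - V.starProjection w⟫_ℂ = ⟪y - V.starProjection y, w⟫_ℂ := by
    intro w
    rw [inner_sub_left, inner_sub_right, Submodule.inner_starProjection_left_eq_right]
  have heq : ⟪y, (T - (V.starProjection * T + (T - V.starProjection * T) * U.starProjection)) x⟫_ℂ
      = ⟪y - V.starProjection y, T (x - U.starProjection x)⟫_ℂ := by
    rw [← hsa]
    congr 1
    simp only [sub_apply, add_apply, mul_apply_eq_comp, map_sub]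
    abel
  have hle : ∀ (K : Submodule ℂ H) [FiniteDimensional ℂ K] (z : H), ‖z‖ = 1 →
      ‖z - K.starProjection z‖ ≤ 1 := by
    intro K _ z hz
    rw [← hz, ← Submodule.starProjection_orthogonal_val]
    exact Submodule.norm_starProjection_apply_le _ z
  rw [heq]
  refine (key' _ (U.sub_starProjection_mem_orthogonal x) _
    (V.sub_starProjection_mem_orthogonal y)).trans ?_
  calc _ ≤ δ * 1 * 1 := by
        gcongr
        · exact hle V y hy
        · exact hle U x hx
    _ = δ := by ring

end Compactness

/-! ### Functionals on `B_q` come from operators in `B_p` -/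

section Representation

variable {H : Type u} [NormedAddCommGroup H] [InnerProductSpace ℂ H] [CompleteSpace H]

theorem Complex.exists_mul_eq_norm (w : ℂ) : ∃ u : ℂ, ‖u‖ ≤ 1 ∧ u * w = ‖w‖ := by
  by_cases hw : w = 0
  · exact ⟨0, by simp, by simp [hw]⟩
  · have hw' : (‖w‖ : ℂ) ≠ 0 := by simpa using hw
    refine ⟨starRingEnd ℂ w / ‖w‖, by simp [norm_ne_zero_iff.2 hw], ?_⟩
    rw [div_mul_eq_mul_div, Complex.conj_mul', sq, mul_div_cancel_right₀ _ hw']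

/-- The extremal case of Hölder's inequality for finite sums of complex numbers. -/
theorem exists_sum_mul_eq_Lp {κ : Type*} [Fintype κ] {p q : ℝ} (hpq : p.HolderConjugate q)
    (z : κ → ℂ) : ∃ c : κ → ℂ, ∑ k, ‖c k‖ₑ ^ q ≤ 1 ∧
      ‖∑ k, c k * z k‖ₑ = (∑ k, ‖z k‖ₑ ^ p) ^ (1 / p) := by
  obtain ⟨⟨g, hg, hgz⟩, -⟩ := NNReal.isGreatest_Lp Finset.univ (fun k => ‖z k‖₊) hpq
  have hp := hpq.pos
  have hq := hpq.symm.pos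
  choose u hu1 hu2 using Complex.exists_mul_eq_norm
  -- The extremizer `g` for the moduli, with phases `u` that make every term nonnegative.
  refine ⟨fun k => (g k : ℂ) * u (z k), ?_, ?_⟩
  · have hg' : ∑ k, (g k : ℝ≥0∞) ^ q ≤ 1 := by
      simp_rw [← ENNReal.coe_rpow_of_nonneg _ hq.le]
      exact_mod_cast hg
    refine le_trans (Finset.sum_le_sum fun k _ => ENNReal.rpow_le_rpow ?_ hq.le) hg'
    rw [enorm_mul]
    have h1 : ‖u (z k)‖ₑ ≤ 1 := by
      rw [← ofReal_norm, ← ENNReal.ofReal_one]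
      exact ENNReal.ofReal_le_ofReal (hu1 _)
    have h2 : ‖((g k : ℝ) : ℂ)‖ₑ = g k := by
      rw [← ofReal_norm]; simp
    calc _ ≤ ‖((g k : ℝ) : ℂ)‖ₑ * 1 := by gcongr
      _ = _ := by rw [h2, mul_one]
  · have h1 : ∑ k, (g k : ℂ) * u (z k) * z k = ((∑ k, ‖z k‖₊ * g k : NNReal) : ℂ) := by
      push_cast
      refine Finset.sum_congr rfl fun k _ => ?_
      rw [mul_assoc, hu2, mul_comm]
    rw [h1]
    have h2 : ∀ r : NNReal, ‖((r : ℝ) : ℂ)‖ₑ = r := by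
      intro r
      rw [← ofReal_norm]; simp
    rw [h2]
    have hgz' : ∑ k, ‖z k‖₊ * g k = (∑ k, ‖z k‖₊ ^ p) ^ (1 / p) := hgz
    rw [hgz', ENNReal.coe_rpow_of_nonneg _ (by positivity), ENNReal.ofNNReal_finsetSum]
    simp_rw [ENNReal.coe_rpow_of_nonneg _ hp.le, enorm_eq_nnnorm]

/-- Conjugate exponents `p < ∞` and `q`. -/
structure DualExponents (p q : ℝ≥0∞) : Prop where
  ne_top : p ≠ ∞
  conj : (p = 1 ∧ q = ∞) ∨ (q ≠ ∞ ∧ p.toReal.HolderConjugate q.toReal)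

variable {p q : ℝ≥0∞} [hp1 : Fact (1 ≤ p)] [hq1 : Fact (1 ≤ q)]

namespace SchattenSpace

/-- Evaluate `φ` at `∑ₖ cₖ ⟨fₖ, ·⟩ eₖ` with `c` extremal in Hölder's inequality; for `q = ∞` the
`cₖ` are phases. The Bessel property keeps the `q`-norm of this operator at most one. -/
theorem sum_enorm_inner_le (hpq : DualExponents p q) {φ : StrongDual ℂ (SchattenSpace H q)}
    {T : H →L[ℂ] H} (hφ : ∀ x y, φ (rankOne q x y) = ⟪y, T x⟫_ℂ) {κ : Type*} [Fintype κ]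
    {e f : κ → H} (he : IsBessel e) (hf : IsBessel f) :
    (∑ k, ‖⟪f k, T (e k)⟫_ℂ‖ₑ ^ p.toReal) ^ (1 / p.toReal) ≤ ‖φ‖ₑ := by
  obtain ⟨c, hc, hcz⟩ : ∃ c : κ → ℂ,
      schattenENorm q (∑ k, c k • InnerProductSpace.rankOne ℂ (e k) (f k)) ≤ 1 ∧
      ‖∑ k, c k * ⟪f k, T (e k)⟫_ℂ‖ₑ =
        (∑ k, ‖⟪f k, T (e k)⟫_ℂ‖ₑ ^ p.toReal) ^ (1 / p.toReal) := by
    rcases hpq.conj with ⟨rfl, rfl⟩ | ⟨hq, hpq'⟩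
    · choose u hu1 hu2 using Complex.exists_mul_eq_norm
      refine ⟨fun k => u ⟪f k, T (e k)⟫_ℂ, ?_, ?_⟩
      · rw [schattenENorm_top, ← ofReal_norm, ← ENNReal.ofReal_one]
        exact ENNReal.ofReal_le_ofReal (he.norm_sum_rankOne_le hf fun k => hu1 _)
      · simp only [hu2, ENNReal.toReal_one, ENNReal.rpow_one, div_one]
        rw [← Complex.ofReal_sum, ← ofReal_norm, Complex.norm_real,
          Real.norm_of_nonneg (by positivity),
          ENNReal.ofReal_sum_of_nonneg (fun _ _ => norm_nonneg _)]
        simp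
    · obtain ⟨c, hc, hcz⟩ := exists_sum_mul_eq_Lp hpq' fun k => ⟪f k, T (e k)⟫_ℂ
      refine ⟨c, (he.schattenENorm_sum_rankOne_le hq1.out hq hf c).trans ?_, hcz⟩
      exact ENNReal.rpow_le_one hc (by positivity)
  let X : SchattenSpace H q := ∑ k, c k • rankOne q (e k) (f k)
  have hX : ‖X‖ₑ ≤ 1 := by
    rw [enorm_def]
    simpa [X] using hc
  have hφX : φ X = ∑ k, c k * ⟪f k, T (e k)⟫_ℂ := by
    simp [X, hφ]
  rw [← hcz, ← hφX]
  calc _ ≤ ‖φ‖ₑ * ‖X‖ₑ := φ.le_opENorm X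
    _ ≤ ‖φ‖ₑ * 1 := by gcongr
    _ = _ := mul_one _

/-- Orthonormal test families give compactness first; only then is a singular basis available, and
testing on its finite parts bounds the `p`-norm. -/
theorem mem_schattenClass_of_dual (hpq : DualExponents p q)
    {φ : StrongDual ℂ (SchattenSpace H q)}
    {T : H →L[ℂ] H} (hφ : ∀ x y, φ (rankOne q x y) = ⟪y, T x⟫_ℂ) :
    T ∈ schattenClass H p ∧ schattenENorm p T ≤ ‖φ‖ₑ := by
  have h1 := one_le_toReal hp1.out hpq.ne_top
  have hp0 : 0 < p.toReal := by linarith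
  have hsum : ∀ {κ : Type u} [Fintype κ] {e f : κ → H}, IsBessel e → IsBessel f →
      ∑ k, ‖⟪f k, T (e k)⟫_ℂ‖ₑ ^ p.toReal ≤ ‖φ‖ₑ ^ p.toReal := by
    intro κ _ e f he hf
    have h := sum_enorm_inner_le hpq hφ he hf
    rwa [one_div, ENNReal.rpow_inv_le_iff hp0] at h
  have hT : IsCompactOperator T := by
    refine isCompactOperator_of_sum_enorm_inner_le hp0
      (ENNReal.rpow_ne_top_of_nonneg hp0.le (enorm_ne_top (x := φ))) fun n e f he hf => ?_
    have h := sum_enorm_inner_le hpq hφ he.isBessel hf.isBessel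
    rwa [one_div, ENNReal.rpow_inv_le_iff hp0] at h
  have hle : schattenENorm p T ≤ ‖φ‖ₑ := by
    obtain ⟨ι, a, g, hg, -, hga, ha⟩ := exists_singular_basis hT
    rw [schattenENorm_of_eigenbasis hp1.out hpq.ne_top a ha, one_div,
      ENNReal.rpow_inv_le_iff hp0, ENNReal.tsum_eq_iSup_sum]
    refine iSup_le fun s => ?_
    refine le_trans (le_of_eq ?_) (hsum
      (a.orthonormal.isBessel.comp (Subtype.val_injective (p := (· ∈ s))))
      (hg.comp Subtype.val_injective))
    rw [← Finset.sum_coe_sort]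
    refine Finset.sum_congr rfl fun i _ => ?_
    simp only [Function.comp_apply]
    rw [hga, ← ofReal_norm, ← ofReal_norm]
    simp
  exact ⟨⟨hT, hle.trans_lt enorm_lt_top⟩, hle⟩

end SchattenSpace

end Representation

/-! ### The transpose `C X* C` and descent to skew-symmetric operators -/

section Conjugation

variable {H : Type u} [NormedAddCommGroup H] [InnerProductSpace ℂ H] [CompleteSpace H]

namespace IsConjugation

variable {C : H →ₛₗ[starRingEnd ℂ] H} (hC : IsConjugation C)

/-- The operator `C X* C`. -/
def transposeOp (X : H →L[ℂ] H) : H →L[ℂ] H :=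
  LinearMap.mkContinuous
    { toFun := fun x => C (ContinuousLinearMap.adjoint X (C x))
      map_add' := fun x y => by simp
      map_smul' := fun c x => by simp }
    ‖X‖ fun x => by
      change ‖C (ContinuousLinearMap.adjoint X (C x))‖ ≤ _
      rw [hC.norm_map]
      refine (ContinuousLinearMap.le_opNorm _ _).trans ?_
      rw [LinearIsometryEquiv.norm_map, hC.norm_map]

theorem transposeOp_apply (X : H →L[ℂ] H) (x : H) :
    hC.transposeOp X x = C (ContinuousLinearMap.adjoint X (C x)) := rfl

theorem norm_transposeOp_le (X : H →L[ℂ] H) : ‖hC.transposeOp X‖ ≤ ‖X‖ :=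
  LinearMap.mkContinuous_norm_le _ (norm_nonneg X) _

/-- The linear map `X ↦ C X* C`. -/
def transpose : (H →L[ℂ] H) →L[ℂ] (H →L[ℂ] H) :=
  LinearMap.mkContinuous
    { toFun := fun X => hC.transposeOp X
      map_add' := fun X Y => by
        ext x
        simp [transposeOp_apply]
      map_smul' := fun c X => by
        have h : ContinuousLinearMap.adjoint (c • X) =
            (starRingEnd ℂ) c • ContinuousLinearMap.adjoint X := map_smulₛₗ _ c X
        ext x
        simp [transposeOp_apply, h] }
    1 fun X => (hC.norm_transposeOp_le X).trans (one_mul _).ge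

theorem transpose_apply (X : H →L[ℂ] H) (x : H) :
    hC.transpose X x = C (ContinuousLinearMap.adjoint X (C x)) := rfl

theorem inner_transpose (X : H →L[ℂ] H) (x y : H) :
    ⟪y, hC.transpose X x⟫_ℂ = ⟪C x, X (C y)⟫_ℂ := by
  rw [transpose_apply, hC.inner_apply_right, ContinuousLinearMap.adjoint_inner_left]

theorem transpose_transpose (X : H →L[ℂ] H) : hC.transpose (hC.transpose X) = X := by
  ext x
  refine ext_inner_left ℂ fun y => ?_
  rw [inner_transpose, inner_transpose, hC.involutive, hC.involutive]

theorem transpose_rankOne (x y : H) :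
    hC.transpose (InnerProductSpace.rankOne ℂ x y) = InnerProductSpace.rankOne ℂ (C y) (C x) := by
  ext a
  refine ext_inner_left ℂ fun b => ?_
  rw [inner_transpose, InnerProductSpace.rankOne_apply, InnerProductSpace.rankOne_apply,
    inner_smul_right, inner_smul_right, hC.inner_apply_left a, hC.inner_apply_right b, mul_comm]

/-- Applying the defining identity at `C x` and then `C` exhibits the skew operators as an
eigenspace of a linear involution. -/
theorem mem_skewSymmetric_iff {X : H →L[ℂ] H} :
    X ∈ skewSymmetric C ↔ hC.transpose X = -X := by
  change (∀ x, C (X (C x)) = -(ContinuousLinearMap.adjoint X x)) ↔ _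
  constructor
  · intro h
    ext x
    have h1 := h (C x)
    rw [hC.involutive] at h1
    rw [transpose_apply, ← neg_eq_iff_eq_neg.2 h1, map_neg, hC.involutive]
    rfl
  · intro h x
    have h1 : hC.transpose X (C x) = -(X (C x)) := by rw [h]; rfl
    rw [transpose_apply, hC.involutive] at h1
    rw [← neg_eq_iff_eq_neg, ← map_neg, ← h1, hC.involutive]

/-- The transpose is norm continuous and maps rank one operators to rank one operators, and compact
operators are limits of finite rank ones. -/
theorem isCompactOperator_transpose {X : H →L[ℂ] H} (hX : IsCompactOperator X) :
    IsCompactOperator (hC.transpose X) := by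
  refine isCompactOperator_of_mem_closure_finiteRank
    (map_mem_closure hC.transpose.continuous hX.mem_closure_finiteRank ?_)
  have h : finiteRank H ≤ (finiteRank H).comap (hC.transpose : (H →L[ℂ] H) →ₗ[ℂ] (H →L[ℂ] H)) := by
    conv_lhs => rw [finiteRank]
    rw [Submodule.span_le]
    rintro _ ⟨v, rfl⟩
    change hC.transpose (InnerProductSpace.rankOne ℂ v.1 v.2) ∈ finiteRank H
    rw [transpose_rankOne]
    exact rankOne_mem_finiteRank _ _
  exact h

/-- For `p < ∞`, the entry of the transpose at `(gᵢ, aᵢ)` is `⟨C aᵢ, X (C gᵢ)⟩`, and `C` preserves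
Bessel families. -/
theorem schattenENorm_transpose_le {p : ℝ≥0∞} (hp1 : 1 ≤ p) {X : H →L[ℂ] H}
    (hX : IsCompactOperator X) : schattenENorm p (hC.transpose X) ≤ schattenENorm p X := by
  by_cases hp : p = ∞
  · rw [hp, schattenENorm_top, schattenENorm_top, ← ofReal_norm, ← ofReal_norm]
    refine ENNReal.ofReal_le_ofReal ?_
    exact hC.norm_transposeOp_le X
  obtain ⟨ι, a, g, hg, -, hga, ha⟩ := exists_singular_basis (hC.isCompactOperator_transpose hX)
  rw [schattenENorm_of_eigenbasis hp1 hp a ha]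
  refine le_trans (le_of_eq ?_) ((hg.conj hC).tsum_enorm_inner_le hp1 hp hX
    (a.orthonormal.isBessel.conj hC))
  congr 1
  refine tsum_congr fun i => ?_
  rw [← hC.inner_transpose, hga, ← ofReal_norm, ← ofReal_norm]
  simp

variable {p : ℝ≥0∞} [hp1 : Fact (1 ≤ p)]

theorem transpose_mem_schattenClass {X : H →L[ℂ] H} (hX : X ∈ schattenClass H p) :
    hC.transpose X ∈ schattenClass H p :=
  ⟨hC.isCompactOperator_transpose hX.1,
    (hC.schattenENorm_transpose_le hp1.out hX.1).trans_lt hX.2⟩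

/-- The map `X ↦ C X* C` on the Schatten space. -/
def schattenTranspose (p : ℝ≥0∞) [hp1 : Fact (1 ≤ p)] :
    SchattenSpace H p →ₗ[ℂ] SchattenSpace H p where
  toFun X := .mk (hC.transpose (SchattenSpace.toCLM X))
    (hC.transpose_mem_schattenClass (SchattenSpace.toCLM_mem X))
  map_add' X Y := SchattenSpace.toCLM_injective (by simp)
  map_smul' c X := SchattenSpace.toCLM_injective (by simp)

theorem toCLM_schattenTranspose (X : SchattenSpace H p) :
    SchattenSpace.toCLM (hC.schattenTranspose p X) = hC.transpose (SchattenSpace.toCLM X) := rfl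

theorem norm_schattenTranspose_le (X : SchattenSpace H p) : ‖hC.schattenTranspose p X‖ ≤ ‖X‖ :=
  ENNReal.toReal_mono (SchattenSpace.toCLM_mem X).2.ne
    (hC.schattenENorm_transpose_le hp1.out (SchattenSpace.toCLM_mem X).1)

theorem schattenTranspose_rankOne (x y : H) :
    hC.schattenTranspose p (SchattenSpace.rankOne p x y) = SchattenSpace.rankOne p (C y) (C x) :=
  SchattenSpace.toCLM_injective (hC.transpose_rankOne x y)

theorem mem_skewSchatten_iff {X : SchattenSpace H p} :
    X ∈ skewSchatten C p ↔ hC.schattenTranspose p X = -X := by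
  rw [skewSchatten, Submodule.mem_comap, hC.mem_skewSymmetric_iff, ← toCLM_schattenTranspose,
    ← map_neg, SchattenSpace.toCLM_injective.eq_iff]

theorem schattenTranspose_schattenTranspose (X : SchattenSpace H p) :
    hC.schattenTranspose p (hC.schattenTranspose p X) = X :=
  SchattenSpace.toCLM_injective (hC.transpose_transpose _)

/-- The contractive projection `X ↦ (X - C X* C) / 2` onto the skew-symmetric operators. -/
def skewProj (p : ℝ≥0∞) [hp1 : Fact (1 ≤ p)] : SchattenSpace H p →L[ℂ] skewSchatten C p :=
  LinearMap.mkContinuous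
    (LinearMap.codRestrict (skewSchatten C p)
      ((2⁻¹ : ℂ) • (LinearMap.id - hC.schattenTranspose p)) fun X => by
        rw [hC.mem_skewSchatten_iff]
        simp only [LinearMap.smul_apply, LinearMap.sub_apply, LinearMap.id_apply, map_smul,
          map_sub, schattenTranspose_schattenTranspose]
        rw [← smul_neg, neg_sub])
    1 fun X => by
      change ‖(2⁻¹ : ℂ) • (X - hC.schattenTranspose p X)‖ ≤ 1 * ‖X‖
      rw [norm_smul]
      have h := norm_sub_le X (hC.schattenTranspose p X)
      have h' := hC.norm_schattenTranspose_le X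
      norm_num
      linarith

theorem coe_skewProj (X : SchattenSpace H p) :
    (hC.skewProj p X : SchattenSpace H p) = (2⁻¹ : ℂ) • (X - hC.schattenTranspose p X) := rfl

theorem norm_skewProj_le : ‖hC.skewProj p‖ ≤ 1 :=
  LinearMap.mkContinuous_norm_le _ zero_le_one _

theorem skewProj_schattenTranspose (X : SchattenSpace H p) :
    hC.skewProj p (hC.schattenTranspose p X) = -hC.skewProj p X := by
  refine Subtype.ext ?_
  rw [NegMemClass.coe_neg, coe_skewProj, coe_skewProj, schattenTranspose_schattenTranspose,
    ← smul_neg, neg_sub]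

theorem skewProj_coe (X : skewSchatten C p) : hC.skewProj p X = X := by
  refine Subtype.ext ?_
  rw [coe_skewProj, hC.mem_skewSchatten_iff.1 X.2, sub_neg_eq_add, ← two_smul ℂ, smul_smul]
  norm_num

/-- If trace duality identifies a space `E` of operators which is invariant under `X ↦ C X* C` with
the dual of a Schatten class, then it identifies the skew-symmetric parts. -/
theorem exists_skew_duality {E : Type*} [NormedAddCommGroup E] [NormedSpace ℂ E]
    (j : E →ₗ[ℂ] (H →L[ℂ] H)) (hj : Function.Injective j)
    (htrace : ∀ (T : E) (X : SchattenSpace H p),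
      schattenENorm 1 (SchattenSpace.toCLM X * j T) ≤ ‖X‖ₑ * ‖T‖ₑ)
    (hrep : ∀ φ : StrongDual ℂ (SchattenSpace H p), ∃ T : E, ‖T‖ ≤ ‖φ‖ ∧
      ∀ x y, φ (SchattenSpace.rankOne p x y) = ⟪y, j T x⟫_ℂ)
    (hinv : ∀ T, ∃ T', j T' = hC.transpose (j T))
    (S : Submodule ℂ E) (hS : ∀ T, T ∈ S ↔ j T ∈ skewSymmetric C) :
    ∃ ψ : S ≃ₗᵢ[ℂ] StrongDual ℂ (skewSchatten C p), ∀ (T : S) (X : skewSchatten C p),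
      HasTrace (SchattenSpace.toCLM (X : SchattenSpace H p) * j T) (ψ T X) := by
  choose Φ hΦn hΦ using fun T : E =>
    SchattenSpace.exists_traceFunctional (p := p) (enorm_ne_top (x := T)) (htrace T)
  have hΦr : ∀ T x y, Φ T (SchattenSpace.rankOne p x y) = ⟪y, j T x⟫_ℂ := fun T x y => by
    rw [← opTrace_rankOne_mul]
    exact ((hΦ T _).opTrace_eq).symm
  let ψ₀ : S →ₗ[ℂ] StrongDual ℂ (skewSchatten C p) :=
    { toFun := fun T => (Φ T).comp (skewSchatten C p).subtypeL
      map_add' := fun T T' => by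
        rw [← ContinuousLinearMap.add_comp]
        congr 1
        exact SchattenSpace.dual_ext fun x y => by simp [hΦr]
      map_smul' := fun c T => by
        rw [RingHom.id_apply, ← ContinuousLinearMap.smul_comp]
        congr 1
        exact SchattenSpace.dual_ext fun x y => by simp [hΦr] }
  -- For skew `T` the trace functional is odd under transposition, so it factors through the
  -- projection; rank one operators suffice to check this.
  have hψ₀ : ∀ T : S, (ψ₀ T).comp (hC.skewProj p) = Φ T := by
    intro T
    refine SchattenSpace.dual_ext fun x y => ?_
    change Φ T ((2⁻¹ : ℂ) • (SchattenSpace.rankOne p x y - hC.schattenTranspose p _)) = _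
    have h1 : hC.transpose (j T) = -j T := hC.mem_skewSymmetric_iff.1 ((hS T).1 T.2)
    have h2 : ⟪C x, j T (C y)⟫_ℂ = -⟪y, j T x⟫_ℂ := by
      rw [← hC.inner_transpose, h1, ← inner_neg_right]
      rfl
    rw [schattenTranspose_rankOne, map_smul, map_sub, hΦr, hΦr, h2, smul_eq_mul]
    ring
  have hnorm : ∀ T : S, ‖ψ₀ T‖ = ‖T‖ := by
    intro T
    apply le_antisymm
    · calc ‖ψ₀ T‖ ≤ ‖Φ T‖ * ‖(skewSchatten C p).subtypeL‖ := ContinuousLinearMap.opNorm_comp_le _ _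
        _ ≤ ‖(T : E)‖ * 1 := by
            gcongr
            · simpa using hΦn T
            · exact Submodule.norm_subtypeL_le _
        _ = ‖T‖ := mul_one _
    -- The operator representing `Φ T` with norm control has the same matrix entries as `T`, hence
    -- is `T`; so `‖T‖ ≤ ‖Φ T‖`, and the factorization reduces this to `‖ψ₀ T‖`.
    · obtain ⟨T', hT'n, hT'⟩ := hrep (Φ T)
      have hTT' : T' = T := by
        refine hj (ContinuousLinearMap.ext fun x => ext_inner_left ℂ fun y => ?_)
        rw [← hT', hΦr]
      calc ‖T‖ = ‖T'‖ := by rw [hTT']; rfl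
        _ ≤ ‖(ψ₀ T).comp (hC.skewProj p)‖ := by rwa [hψ₀]
        _ ≤ ‖ψ₀ T‖ * ‖hC.skewProj p‖ := ContinuousLinearMap.opNorm_comp_le _ _
        _ ≤ ‖ψ₀ T‖ * 1 := by
            gcongr
            exact hC.norm_skewProj_le
        _ = _ := mul_one _
  have hsurj : Function.Surjective ψ₀ := by
    intro χ
    -- Extend `χ` by the projection. The extension is odd under transposition, so the skew part of
    -- the representing operator represents it too.
    obtain ⟨T, -, hT⟩ := hrep (χ.comp (hC.skewProj p))
    obtain ⟨T', hT'⟩ := hinv T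
    have hmem : (2⁻¹ : ℂ) • (T - T') ∈ S := by
      rw [hS, hC.mem_skewSymmetric_iff, map_smul, map_smul, map_sub, map_sub, hT',
        hC.transpose_transpose, ← smul_neg, neg_sub]
    refine ⟨⟨_, hmem⟩, ?_⟩
    have heq : Φ ((2⁻¹ : ℂ) • (T - T')) = χ.comp (hC.skewProj p) := by
      refine SchattenSpace.dual_ext fun x y => ?_
      have h1 : ⟪y, hC.transpose (j T) x⟫_ℂ = -⟪y, j T x⟫_ℂ := by
        rw [hC.inner_transpose, ← hT, ← hT, ← hC.schattenTranspose_rankOne,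
          ContinuousLinearMap.comp_apply, skewProj_schattenTranspose, map_neg]
        rfl
      rw [hΦr, hT, map_smul, map_sub, hT', smul_apply, sub_apply, inner_smul_right,
        inner_sub_right, h1]
      ring
    ext X
    change Φ ((2⁻¹ : ℂ) • (T - T')) X = χ X
    rw [heq, ContinuousLinearMap.comp_apply, skewProj_coe]
  refine ⟨LinearIsometryEquiv.ofSurjective ⟨ψ₀, hnorm⟩ hsurj, fun T X => ?_⟩
  exact hΦ T X

end IsConjugation

end Conjugation
end

/-! ### The three dualities -/

theorem proposition2p9 {H : Type u} [NormedAddCommGroup H] [InnerProductSpace ℂ H]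
    [CompleteSpace H] [TopologicalSpace.SeparableSpace H]
    (C : H →ₛₗ[starRingEnd ℂ] H) (hC : IsConjugation C) :
    (∃ ψ : skewSymmetric C ≃ₗᵢ[ℂ] StrongDual ℂ (skewSchatten C 1),
      ∀ (T : skewSymmetric C) (X : skewSchatten C 1),
        HasTrace (SchattenSpace.toCLM (X : SchattenSpace H 1) * (T : H →L[ℂ] H)) (ψ T X)) ∧
    (∃ ψ : skewSchatten C 1 ≃ₗᵢ[ℂ] StrongDual ℂ (skewSchatten C ∞),
      ∀ (T : skewSchatten C 1) (X : skewSchatten C ∞),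
        HasTrace (SchattenSpace.toCLM (X : SchattenSpace H ∞) *
          SchattenSpace.toCLM (T : SchattenSpace H 1)) (ψ T X)) ∧
    (∀ (p q : ℝ≥0∞) [Fact (1 ≤ p)] [Fact (1 ≤ q)], 1 < p → p < ∞ → 1 < q → q < ∞ →
      1 / p + 1 / q = 1 →
      ∃ ψ : skewSchatten C p ≃ₗᵢ[ℂ] StrongDual ℂ (skewSchatten C q),
        ∀ (T : skewSchatten C p) (X : skewSchatten C q),
          HasTrace (SchattenSpace.toCLM (X : SchattenSpace H q) *
            SchattenSpace.toCLM (T : SchattenSpace H p)) (ψ T X)) := by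
  -- Only an inequality, since `H` may be zero.
  have hone : ‖(1 : H →L[ℂ] H)‖ₑ ≤ 1 := by
    rw [← ofReal_norm, ← ENNReal.ofReal_one]
    exact ENNReal.ofReal_le_ofReal ContinuousLinearMap.norm_id_le
  have hschatten : ∀ {p q : ℝ≥0∞} [Fact (1 ≤ p)] [Fact (1 ≤ q)], DualExponents p q →
      (∀ (T : SchattenSpace H p) (X : SchattenSpace H q),
        schattenENorm 1 (SchattenSpace.toCLM X * SchattenSpace.toCLM T) ≤ ‖X‖ₑ * ‖T‖ₑ) →
      ∃ ψ : skewSchatten C p ≃ₗᵢ[ℂ] StrongDual ℂ (skewSchatten C q),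
        ∀ (T : skewSchatten C p) (X : skewSchatten C q),
          HasTrace (SchattenSpace.toCLM (X : SchattenSpace H q) *
            SchattenSpace.toCLM (T : SchattenSpace H p)) (ψ T X) := by
    intro p q _ _ hpq hle
    refine hC.exists_skew_duality SchattenSpace.toCLM SchattenSpace.toCLM_injective hle
      (fun φ => ?_) (fun T => ⟨hC.schattenTranspose p T, rfl⟩) _ fun T => Iff.rfl
    obtain ⟨T, -, hT⟩ := SchattenSpace.exists_inner_eq_dual φ
    obtain ⟨hmem, hn⟩ := SchattenSpace.mem_schattenClass_of_dual hpq hT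
    refine ⟨.mk T hmem, ?_, hT⟩
    simpa [SchattenSpace.norm_def] using ENNReal.toReal_mono enorm_ne_top hn
  refine ⟨?_, ?_, ?_⟩
  · refine hC.exists_skew_duality LinearMap.id Function.injective_id (fun T X => ?_)
      SchattenSpace.exists_inner_eq_dual (fun T => ⟨_, rfl⟩) _ fun T => Iff.rfl
    -- The ideal property with `X` as the trace class factor; in case (ii) that factor is `T`.
    have h := schattenENorm_one_mul_mul_le (SchattenSpace.toCLM_mem X).1 1 T
    rw [one_mul, ← SchattenSpace.enorm_def] at h
    refine h.trans ?_
    gcongr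
    exact mul_le_of_le_one_left' hone
  · refine hschatten ⟨ENNReal.one_ne_top, Or.inl ⟨rfl, rfl⟩⟩ fun T X => ?_
    have h := schattenENorm_one_mul_mul_le (SchattenSpace.toCLM_mem T).1
      (SchattenSpace.toCLM X) 1
    rw [mul_one, ← SchattenSpace.enorm_def, ← schattenENorm_top, ← SchattenSpace.enorm_def] at h
    exact h.trans (mul_le_of_le_one_right' hone)
  · intro p q hp1 hq1 hp hp' hq hq' hpq
    have hconj : p.toReal.HolderConjugate q.toReal := by
      rw [Real.holderConjugate_iff]
      constructor
      · simpa using ENNReal.toReal_strict_mono hp'.ne hp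
      · have h := congrArg ENNReal.toReal hpq
        rw [ENNReal.toReal_add (by simp [(zero_lt_one.trans hp).ne'])
          (by simp [(zero_lt_one.trans hq).ne'])] at h
        simpa using h
    refine hschatten ⟨hp'.ne, Or.inr ⟨hq'.ne, hconj⟩⟩ fun T X => ?_
    rw [SchattenSpace.enorm_def, SchattenSpace.enorm_def]
    exact schattenENorm_one_mul_le hp1.out hp'.ne hq1.out hq'.ne hconj (SchattenSpace.toCLM_mem X).1
      (SchattenSpace.toCLM_mem T).1
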